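/- Let $d\ge 1$ and let $\mathbb{D}^d=\{z\in\mathbb{C}^d : |z_i|<1 \text{ for all } i\}$. For a holomorphic function $f:\mathbb{D}^d\to\mathbb{C}$ with power series expansion $f(z)=\sum_{\alpha\in\mathbb{N}_0^d}c_\alpha z^\alpha$ and a commuting tuple $\mathbf{T}=(T_1,\dots,T_d)$ of bounded operators on a complex Hilbert space with $\|T_i\|<1$ for all $i$, put $f(\mathbf{T})=\sum_{\alpha}c_\alpha T_1^{\alpha_1}\cdots T_d^{\alpha_d}$ (the series converges absolutely in operator norm), and let $$\|f\|_{\mathrm{SA}}=\sup\{\|f(\mathbf{T})\| : \mathbf{T}\text{ is a commuting } d\text{-tuple of strict contractions on a complex Hilbert space}\}\in[0,\infty].$$ A function $k:\mathbb{D}^d\times\mathbb{D}^d\to\mathbb{C}$ is called a positive definite kernel if $\sum_{p,q=1}^n \overline{a_p}\,a_q\,k(x_p,x_q)\ge 0$ for all $n$, all $x_1,\dots,x_n\in\mathbb{D}^d$ and all $a_1,\dots,a_n\in\mathbb{C}$. **Theorem (Agler).** A bounded holomorphic function $f$ on $\mathbb{D}^d$ satisfies $\|f\|_{\mathrm{SA}}\le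 1$ if and only if there exist positive definite kernels $k_1,\dots,k_d$ on $\mathbb{D}^d$ such that $$1-f(z)\overline{f(w)}=\sum_{i=1}^d(1-z_i\overline{w_i})\,k_i(z,w)\qquad\text{for all } z,w\in\mathbb{D}^d.$$ -/

import Mathlib

open scoped ENNReal ComplexConjugate

universe u

/-- The open unit polydisc in `ℂ^d`. -/
def polydisc (d : ℕ) : Set (Fin d → ℂ) := {z | ∀ i, ‖z i‖ < 1}

/-- `c` is the family of coefficients of a power series at `0` which converges to `f` on the whole
polydisc: `f z = ∑ α, c α * z ^ α` (unconditional, i.e. absolute, convergence). -/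
def IsPowerSeriesExpansion {d : ℕ} (f : (Fin d → ℂ) → ℂ) (c : (Fin d → ℕ) → ℂ) : Prop :=
  ∀ z ∈ polydisc d, HasSum (fun α : Fin d → ℕ => c α * ∏ i, z i ^ α i) (f z)

/-- A power series in one variable which vanishes on the unit disc is zero. -/
theorem coeff_eq_zero_of_hasSum_zero {a : ℕ → ℂ}
    (h : ∀ z : ℂ, ‖z‖ < 1 → HasSum (fun n => z ^ n * a n) 0) : a = 0 := by
  have h1 : HasFPowerSeriesAt (0 : ℂ → ℂ) (FormalMultilinearSeries.ofScalars ℂ a) 0 := by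
    rw [hasFPowerSeriesAt_iff]
    filter_upwards [Metric.ball_mem_nhds (0 : ℂ) one_pos] with z hz
    simpa [FormalMultilinearSeries.coeff_ofScalars] using h z (by simpa using hz)
  have h2 := h1.eq_zero
  funext n
  rw [← FormalMultilinearSeries.coeff_ofScalars (𝕜 := ℂ) (p := a) (n := n), h2]
  simp [FormalMultilinearSeries.coeff]

/-- A power series in `d` variables which vanishes on the polydisc is zero. -/
theorem IsPowerSeriesExpansion.eq_zero : ∀ {d : ℕ} {c : (Fin d → ℕ) → ℂ},
    IsPowerSeriesExpansion (fun _ => 0) c → c = 0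
  | 0, c, h => by
    have h0 := h 0 (fun i => i.elim0)
    funext α
    have h1 := hasSum_fintype (fun α : Fin 0 → ℕ => c α * ∏ i, (0 : Fin 0 → ℂ) i ^ α i)
    have h2 := h1.unique h0
    rw [Fintype.sum_subsingleton _ α] at h2
    simpa using h2
  | d + 1, c, h => by
    have key : ∀ w ∈ polydisc d, ∀ n : ℕ,
        HasSum (fun β : Fin d → ℕ => c (Fin.cons n β) * ∏ i, w i ^ β i) 0 := by
      intro w hw
      have hs : ∀ z : ℂ, ‖z‖ < 1 → HasSum (fun p : ℕ × (Fin d → ℕ) =>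
          z ^ p.1 * (c (Fin.cons p.1 p.2) * ∏ i, w i ^ p.2 i)) 0 := by
        intro z hz
        have hzw : (Fin.cons z w : Fin (d + 1) → ℂ) ∈ polydisc (d + 1) := by
          intro i
          refine Fin.cases ?_ (fun j => ?_) i
          · simpa using hz
          · simpa using hw j
        have h3 := (Fin.consEquiv (fun _ : Fin (d + 1) => ℕ)).hasSum_iff.mpr (h _ hzw)
        have h4 : (fun p : ℕ × (Fin d → ℕ) =>
            z ^ p.1 * (c (Fin.cons p.1 p.2) * ∏ i, w i ^ p.2 i)) =
            (fun α : Fin (d + 1) → ℕ => c α * ∏ i, (Fin.cons z w : Fin (d + 1) → ℂ) i ^ α i) ∘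
              (Fin.consEquiv (fun _ : Fin (d + 1) => ℕ)) := by
          funext p
          have h5 : Fin.consEquiv (fun _ : Fin (d + 1) => ℕ) p = Fin.cons p.1 p.2 := rfl
          simp only [Function.comp_apply, h5, Fin.prod_univ_succ, Fin.cons_zero, Fin.cons_succ]
          ring
        rw [h4]
        exact h3
      have hfib : ∀ n : ℕ, Summable
          (fun β : Fin d → ℕ => c (Fin.cons n β) * ∏ i, w i ^ β i) := by
        intro n
        have h1 : Summable (fun β : Fin d → ℕ =>
            (1 / 2 : ℂ) ^ n * (c (Fin.cons n β) * ∏ i, w i ^ β i)) :=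
          (hs (1 / 2) (by norm_num)).summable.comp_injective
            (i := fun β : Fin d → ℕ => (n, β)) (Prod.mk_right_injective n)
        have h2 : ((1 / 2 : ℂ) ^ n) ≠ 0 := pow_ne_zero n (by norm_num)
        exact (summable_mul_left_iff h2).mp h1
      have hz : (fun n : ℕ => ∑' β : Fin d → ℕ, c (Fin.cons n β) * ∏ i, w i ^ β i) = 0 := by
        apply coeff_eq_zero_of_hasSum_zero
        intro z hz
        exact HasSum.prod_fiberwise (hs z hz) fun n => (hfib n).hasSum.mul_left (z ^ n)
      intro n
      have := (hfib n).hasSum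
      rwa [show ∑' β : Fin d → ℕ, c (Fin.cons n β) * ∏ i, w i ^ β i = 0 from congrFun hz n] at this
    funext α
    have h1 : (fun β : Fin d → ℕ => c (Fin.cons (α 0) β)) = 0 :=
      IsPowerSeriesExpansion.eq_zero fun w hw => key w hw (α 0)
    have h2 := congrFun h1 (Fin.tail α)
    simpa using h2

/-- The power series expansion is unique. -/
theorem IsPowerSeriesExpansion.unique {d : ℕ} {f : (Fin d → ℂ) → ℂ} {a b : (Fin d → ℕ) → ℂ}
    (ha : IsPowerSeriesExpansion f a) (hb : IsPowerSeriesExpansion f b) : a = b := by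
  have h : IsPowerSeriesExpansion (fun _ => 0) (a - b) := by
    intro z hz
    simpa [sub_mul] using (ha z hz).sub (hb z hz)
  exact sub_eq_zero.mp h.eq_zero

open Classical in
/-- The coefficients of the power series expansion of `f` at `0`. Every holomorphic function on the
polydisc has such an expansion, and it is unique by `IsPowerSeriesExpansion.unique`. -/
noncomputable def powerSeriesCoeff {d : ℕ} (f : (Fin d → ℂ) → ℂ) : (Fin d → ℕ) → ℂ :=
  if h : ∃ c, IsPowerSeriesExpansion f c then h.choose else 0

theorem IsPowerSeriesExpansion.powerSeriesCoeff_eq {d : ℕ} {f : (Fin d → ℂ) → ℂ}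
    {c : (Fin d → ℕ) → ℂ} (hc : IsPowerSeriesExpansion f c) : powerSeriesCoeff f = c := by
  have h : ∃ c, IsPowerSeriesExpansion f c := ⟨c, hc⟩
  rw [powerSeriesCoeff, dif_pos h]
  exact h.choose_spec.unique hc

/-- `f(T) = ∑ α, c α • T₁ ^ α₁ ⋯ T_d ^ α_d`, where `c` are the power series coefficients of `f`
at `0`. For `f` holomorphic on the polydisc and a commuting tuple `T` of strict contractions on a
Hilbert space, the series converges absolutely in operator norm. -/
noncomputable def evalTuple {d : ℕ} (f : (Fin d → ℂ) → ℂ) {H : Type u} [NormedAddCommGroup H]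
    [InnerProductSpace ℂ H] (T : Fin d → H →L[ℂ] H) : H →L[ℂ] H :=
  ∑' α : Fin d → ℕ, powerSeriesCoeff f α • (List.ofFn fun i => T i ^ α i).prod

/-- The Schur–Agler norm: the supremum, in `[0, ∞]`, of `‖f(T)‖` over all commuting `d`-tuples `T`
of strict contractions on complex Hilbert spaces. -/
noncomputable def schurAglerNorm {d : ℕ} (f : (Fin d → ℂ) → ℂ) : ℝ≥0∞ :=
  ⨆ (H : Type u) (_ : NormedAddCommGroup H) (_ : InnerProductSpace ℂ H) (_ : CompleteSpace H)
    (T : Fin d → H →L[ℂ] H) (_ : ∀ i j, Commute (T i) (T j)) (_ : ∀ i, ‖T i‖ < 1),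
    ‖evalTuple f T‖ₑ

open scoped ComplexOrder in
/-- A positive definite kernel on `X`: `k` is Hermitian and `∑ i j, conj (c i) * k (x i) (x j) * c j`
is a nonnegative real for all finitely many points and scalars (semi-definiteness, not strict). -/
def IsPositiveDefiniteKernel {X : Type*} (k : X → X → ℂ) : Prop :=
  (Matrix.of k).PosSemidef

/-! Sufficiency is the lurking isometry argument. Write k_i(z, w) = ⟪v_i(w), v_i(z)⟫
(`exists_kolmogorov_decomposition`). Moving negative terms across, the decomposition says that the
vectors a(z) = (1, z_i v_i(z)) and b(z) = (f(z), v_i(z)) have equal Gram matrices, so one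
contraction V sends every a(z) to b(z) (`exists_contraction_of_inner_eq`). On Taylor coefficients, V
a = b is a recursion that determines the coefficients w_α of b by total degree. Now let T be a
commuting tuple of strict contractions and apply V ⊗ 1 to truncations of ∑ a_α ⊗ T^α x. With p_n the
partial sums of f(T)x and E_n ≥ 0 the energy of the truncated state, contractivity gives ‖p_{n+1}‖²
+ E_{n+1} ≤ ‖x‖² + E_n (`transfer_step`). This telescopes: the averages of ‖p_n‖² are at most ‖x‖²,
hence so is the limit ‖f(T)x‖². Tensor products enter only through their Gram matrices, by way of
the Schur product theorem.

Necessity is cone separation followed by a GNS construction. Over finitely many points the sums ∑ (1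
- z_i conj w_i) k_i form a closed convex cone. If 1 - f conj f were outside it, some functional ℓ
would have nonnegative real part on the cone and negative real part there. After a small multiple of
the trace is added, Re ℓ(g conj g) is a squared Hilbert norm on functions on the points, for which
the coordinate multiplications are commuting strict contractions. Their f-calculus is multiplication
by f, so the norm bound, tested on the constant function 1, contradicts the separation. Compactness
then passes from finite sets to the whole polydisc. -/

/-! ### Kolmogorov decomposition and the lurking isometry -/

open scoped ComplexOrder in
/-- **Kolmogorov decomposition** of a positive definite kernel. -/
theorem exists_kolmogorov_decomposition {X : Type u} {k : X → X → ℂ}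
    (hk : IsPositiveDefiniteKernel k) :
    ∃ (K : Type u) (_ : NormedAddCommGroup K) (_ : InnerProductSpace ℂ K) (_ : CompleteSpace K)
      (u : X → K), ∀ x y, inner ℂ (u y) (u x) = k x y := by
  have hk' : (Matrix.of k).PosSemidef := hk
  let M : Matrix X X (ℂ →L[ℂ] ℂ) := fun x y => (k y x) • ContinuousLinearMap.id ℂ ℂ
  have hM : M.PosSemidef := by
    have ht := (RKHS.posSemidef_tfae (K := M)).out 0 2
    refine ht.mpr ⟨?_, fun v => ?_⟩
    · refine Matrix.IsHermitian.ext fun x y => ?_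
      have hxy : conj (k x y) = k y x := hk'.1.apply y x
      have hid : star (ContinuousLinearMap.id ℂ ℂ) = ContinuousLinearMap.id ℂ ℂ := star_one _
      change star (M y x) = M x y
      simp only [M, star_smul, hid, RCLike.star_def, hxy]
    · refine (RCLike.nonneg_iff.mp (hk'.transpose.2 v)).1.trans_eq ?_
      refine congrArg Complex.re (Finset.sum_congr rfl fun x _ => Finset.sum_congr rfl fun y _ => ?_)
      have hxy : conj (k x y) = k y x := hk'.1.apply y x
      simp only [M, Matrix.transpose_apply, Matrix.of_apply, RCLike.inner_apply,
        smul_apply, ContinuousLinearMap.id_apply, smul_eq_mul, map_mul, hxy,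
        RCLike.star_def]
      ring
  have : Fact M.PosSemidef := ⟨hM⟩
  refine ⟨RKHS.OfKernel M, inferInstance, inferInstance, inferInstance,
    fun x => RKHS.kerFun (RKHS.OfKernel M) x 1, fun x y => ?_⟩
  rw [← RKHS.kernel_inner, RKHS.OfKernel.kernel_ofKernel]
  have := hk'.1.apply x y
  simpa [M] using this

/-- The lurking isometry argument: a correspondence between families of vectors with equal Gram
matrices is implemented by a contraction. -/
theorem exists_contraction_of_inner_eq {X E F : Type*} [NormedAddCommGroup E]
    [InnerProductSpace ℂ E] [CompleteSpace E] [NormedAddCommGroup F] [InnerProductSpace ℂ F]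
    [CompleteSpace F] (a : X → E) (b : X → F)
    (h : ∀ x y, inner ℂ (a x) (a y) = inner ℂ (b x) (b y)) :
    ∃ V : E →L[ℂ] F, (∀ x, ‖V x‖ ≤ ‖x‖) ∧ ∀ x, V (a x) = b x := by
  let La : (X →₀ ℂ) →ₗ[ℂ] E := Finsupp.linearCombination ℂ a
  let Lb : (X →₀ ℂ) →ₗ[ℂ] F := Finsupp.linearCombination ℂ b
  have hL : ∀ v, ‖Lb v‖ = ‖La v‖ := by
    intro v
    have h1 : inner ℂ (Lb v) (Lb v) = inner ℂ (La v) (La v) := by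
      simp only [La, Lb, Finsupp.linearCombination_apply, Finsupp.sum_inner, Finsupp.inner_sum,
        inner_smul_left, inner_smul_right, h]
    rw [← sq_eq_sq₀ (norm_nonneg _) (norm_nonneg _)]
    rw [inner_self_eq_norm_sq_to_K, inner_self_eq_norm_sq_to_K] at h1
    exact_mod_cast h1
  let S : Submodule ℂ E := (LinearMap.range La).topologicalClosure
  let e : (X →₀ ℂ) →ₗ[ℂ] S := La.codRestrict S fun v =>
    Submodule.le_topologicalClosure _ (LinearMap.mem_range_self La v)
  have : CompleteSpace S := (Submodule.isClosed_topologicalClosure _).completeSpace_coe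
  have he : DenseRange e := by
    intro x
    rw [Metric.mem_closure_iff]
    intro ε hε
    have hx : (x : E) ∈ closure (LinearMap.range La : Set E) := x.2
    obtain ⟨y, ⟨v, rfl⟩, hy⟩ := Metric.mem_closure_iff.mp hx ε hε
    exact ⟨e v, ⟨v, rfl⟩, hy⟩
  have hn : ∀ v, ‖Lb v‖ ≤ 1 * ‖e v‖ := fun v => by
    rw [one_mul, hL]; exact le_rfl
  -- The operator is defined by density on the closed span of the `a x` and is zero on its
  -- orthogonal complement, so it stays contractive.
  refine ⟨(Lb.extendOfNorm e).comp S.orthogonalProjectionOnto, fun x => ?_, fun x => ?_⟩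
  · refine (LinearMap.norm_extendOfNorm_apply_le he 1 hn _).trans ?_
    rw [one_mul]
    exact S.norm_orthogonalProjectionOnto_apply_le x
  · have hx : a x = e (Finsupp.single x 1) := by simp [e, La]
    have h2 : S.orthogonalProjectionOnto (a x) = e (Finsupp.single x 1) := by
      rw [hx]; exact S.orthogonalProjectionOnto_mem_subspace_eq_self _
    rw [ContinuousLinearMap.comp_apply, h2, LinearMap.extendOfNorm_eq he ⟨1, hn⟩]
    simp [Lb]

/-! ### Gram sums in place of tensor products -/

/-- The inner product `⟪∑ v j ⊗ τ j, ∑ v j ⊗ τ j⟫` of sums of elementary tensors. -/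
noncomputable def gramSum {ι E H : Type*} [NormedAddCommGroup E] [InnerProductSpace ℂ E]
    [NormedAddCommGroup H] [InnerProductSpace ℂ H] (s : Finset ι) (v : ι → E) (τ : ι → H) : ℂ :=
  ∑ j ∈ s, ∑ k ∈ s, inner ℂ (v j) (v k) * inner ℂ (τ j) (τ k)

section gramSum

variable {ι E F H : Type*} [NormedAddCommGroup E] [InnerProductSpace ℂ E] [NormedAddCommGroup F]
  [InnerProductSpace ℂ F] [NormedAddCommGroup H] [InnerProductSpace ℂ H]

theorem gramSum_comm (s : Finset ι) (v : ι → E) (τ : ι → H) : gramSum s v τ = gramSum s τ v := by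
  simp only [gramSum, mul_comm]

open scoped ComplexOrder in
theorem gramSum_nonneg (s : Finset ι) (v : ι → E) (τ : ι → H) : 0 ≤ (gramSum s v τ).re := by
  have h := ((Matrix.posSemidef_gram ℂ fun j : s => v j).hadamard
    (Matrix.posSemidef_gram ℂ fun j : s => τ j)).dotProduct_mulVec_nonneg 1
  refine (Complex.nonneg_iff.mp h).1.trans_eq ?_
  simp only [dotProduct, Matrix.mulVec, Matrix.hadamard_apply, Matrix.gram_apply, gramSum,
    ← Finset.sum_coe_sort s]
  simp

-- The hypothesis says that Gram(v) - Gram(w) is positive semidefinite. By the Schur product theorem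
-- it stays so after the Hadamard product with Gram(τ); the claim is its value at the all-ones
-- vector.
open scoped ComplexOrder in
theorem gramSum_re_mono {s : Finset ι} {v : ι → E} {w : ι → F}
    (h : ∀ a : ι → ℂ, ‖∑ j ∈ s, a j • w j‖ ≤ ‖∑ j ∈ s, a j • v j‖) (τ : ι → H) :
    (gramSum s w τ).re ≤ (gramSum s v τ).re := by
  classical
  have hd : (Matrix.gram ℂ (fun j : s => v j) - Matrix.gram ℂ fun j : s => w j).PosSemidef := by
    refine .of_dotProduct_mulVec_nonneg
      ((Matrix.isHermitian_gram _ _).sub (Matrix.isHermitian_gram _ _)) fun x => ?_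
    rw [Matrix.sub_mulVec, dotProduct_sub, Matrix.star_dotProduct_gram_mulVec,
      Matrix.star_dotProduct_gram_mulVec, inner_self_eq_norm_sq_to_K, inner_self_eq_norm_sq_to_K]
    have h1 := h fun j => if hj : j ∈ s then x ⟨j, hj⟩ else 0
    rw [← Finset.sum_coe_sort s, ← Finset.sum_coe_sort s] at h1
    simp only [Finset.coe_mem, dite_true, Subtype.coe_eta] at h1
    rw [sub_nonneg]
    have h2 := pow_le_pow_left₀ (norm_nonneg _) h1 2
    exact_mod_cast h2
  have h1 := (hd.hadamard (Matrix.posSemidef_gram ℂ fun j : s => τ j)).dotProduct_mulVec_nonneg 1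
  rw [← sub_nonneg, ← Complex.sub_re]
  refine (Complex.nonneg_iff.mp h1).1.trans_eq ?_
  simp only [dotProduct, Matrix.mulVec, Matrix.hadamard_apply, Matrix.gram_apply, gramSum,
    Matrix.sub_apply, ← Finset.sum_coe_sort s, sub_mul, Finset.sum_sub_distrib]
  simp [Finset.sum_sub_distrib]

theorem gramSum_map_re_le (V : E →L[ℂ] F) (hV : ∀ x, ‖V x‖ ≤ ‖x‖) (s : Finset ι) (v : ι → E)
    (τ : ι → H) : (gramSum s (fun j => V (v j)) τ).re ≤ (gramSum s v τ).re :=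
  gramSum_re_mono (fun a => by simpa using hV (∑ j ∈ s, a j • v j)) τ

theorem gramSum_scalar (s : Finset ι) (c : ι → ℂ) (τ : ι → H) :
    (gramSum s c τ).re = ‖∑ j ∈ s, c j • τ j‖ ^ 2 := by
  have h : gramSum s c τ = inner ℂ (∑ j ∈ s, c j • τ j) (∑ j ∈ s, c j • τ j) := by
    rw [gramSum, sum_inner]
    refine Finset.sum_congr rfl fun j _ => ?_
    rw [inner_sum]
    refine Finset.sum_congr rfl fun k _ => ?_
    rw [inner_smul_left, inner_smul_right, RCLike.inner_apply]
    ring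
  rw [h, ← RCLike.re_eq_complex_re, inner_self_eq_norm_sq]

theorem gramSum_prod (s : Finset ι) (v : ι → WithLp 2 (E × F)) (τ : ι → H) :
    gramSum s v τ = gramSum s (fun j => (v j).fst) τ + gramSum s (fun j => (v j).snd) τ := by
  simp only [gramSum, WithLp.prod_inner_apply, add_mul, Finset.sum_add_distrib]
  rfl

theorem gramSum_pi {d : ℕ} {K : Fin d → Type*} [∀ i, NormedAddCommGroup (K i)]
    [∀ i, InnerProductSpace ℂ (K i)] (s : Finset ι) (v : ι → PiLp 2 K) (τ : ι → H) :
    gramSum s v τ = ∑ i, gramSum s (fun j => v j i) τ := by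
  simp only [gramSum, PiLp.inner_apply, Finset.sum_mul]
  rw [Finset.sum_comm]
  conv_rhs => rw [Finset.sum_comm]
  rw [Finset.sum_comm]
  refine Finset.sum_congr rfl fun j _ => ?_
  rw [Finset.sum_comm]

end gramSum

/-! ### Truncation by total degree and averages -/

/-- The multi-indices of total degree less than `n`. -/
def multiIndexLT (d n : ℕ) : Finset (Fin d → ℕ) :=
  (Fintype.piFinset fun _ => Finset.range n).filter fun α => ∑ i, α i < n

theorem mem_multiIndexLT {d n : ℕ} {α : Fin d → ℕ} : α ∈ multiIndexLT d n ↔ ∑ i, α i < n := by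
  simp only [multiIndexLT, Finset.mem_filter, Fintype.mem_piFinset, Finset.mem_range,
    and_iff_right_iff_imp]
  exact fun h i => (Finset.single_le_sum (fun _ _ => Nat.zero_le _) (Finset.mem_univ i)).trans_lt h

theorem sum_add_single {d : ℕ} (α : Fin d → ℕ) (i : Fin d) :
    ∑ j, (α + Pi.single i 1 : Fin d → ℕ) j = ∑ j, α j + 1 := by
  simp [Finset.sum_add_distrib]

theorem sub_single_add_single {d : ℕ} {α : Fin d → ℕ} {i : Fin d} (h : α i ≠ 0) :
    α - Pi.single i 1 + Pi.single i 1 = α := by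
  funext j
  by_cases hj : j = i
  · subst hj; simp; omega
  · simp [hj]

theorem tendsto_multiIndexLT (d : ℕ) :
    Filter.Tendsto (multiIndexLT d) Filter.atTop Filter.atTop := by
  refine Filter.tendsto_atTop_finset_of_monotone (fun m n hmn α hα => ?_) fun α =>
    ⟨∑ i, α i + 1, mem_multiIndexLT.mpr (Nat.lt_succ_self _)⟩
  rw [mem_multiIndexLT] at hα ⊢
  exact hα.trans_le hmn

theorem sum_multiIndexLT_succ {d n : ℕ} {M : Type*} [AddCommMonoid M] (i : Fin d)
    {F : (Fin d → ℕ) → M} (hF : ∀ α, α i = 0 → F α = 0) :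
    ∑ α ∈ multiIndexLT d (n + 1), F α = ∑ β ∈ multiIndexLT d n, F (β + Pi.single i 1) := by
  refine Eq.trans ?_ (Finset.sum_map (multiIndexLT d n) (addRightEmbedding (Pi.single i 1)) F)
  symm
  refine Finset.sum_subset (fun α hα => ?_) fun α hα hα' => hF α ?_
  · obtain ⟨β, hβ, rfl⟩ := Finset.mem_map.mp hα
    rw [mem_multiIndexLT] at hβ ⊢
    rw [addRightEmbedding_apply, sum_add_single]
    omega
  · by_contra h0
    refine hα' (Finset.mem_map.mpr ⟨α - Pi.single i 1, ?_, sub_single_add_single h0⟩)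
    rw [mem_multiIndexLT] at hα ⊢
    have := sum_add_single (α - Pi.single i 1) i
    rw [sub_single_add_single h0] at this
    omega

/-- If the partial averages of `s` are at most `t`, then `s` cannot eventually exceed `t`. -/
theorem le_of_forall_sum_range_le {s : ℕ → ℝ} {t x : ℝ} (hs : ∀ n, 0 ≤ s n)
    (h : ∀ M : ℕ, ∑ n ∈ Finset.range M, s n ≤ M * t) (hx : ∀ᶠ n in Filter.atTop, x ≤ s n) :
    x ≤ t := by
  obtain ⟨N, hN⟩ := Filter.eventually_atTop.mp hx
  by_contra! hlt
  -- Followed by `m` terms that are each at least `x`, the first `N` terms cannot keep the average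
  -- below `t` once `m * (x - t) > N * t`.
  obtain ⟨m, hm⟩ := exists_nat_gt (N * t / (x - t))
  rw [div_lt_iff₀ (sub_pos.mpr hlt)] at hm
  have h1 := h (N + m)
  rw [Finset.sum_range_add] at h1
  have h2 : (m : ℝ) * x ≤ ∑ k ∈ Finset.range m, s (N + k) := by
    have := Finset.card_nsmul_le_sum (Finset.range m) (fun k => s (N + k)) x
      fun k _ => hN _ (Nat.le_add_right _ _)
    simpa using this
  have h3 : 0 ≤ ∑ k ∈ Finset.range N, s k := Finset.sum_nonneg fun k _ => hs k
  push_cast at h1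
  nlinarith

/-! ### Taylor coefficients of the transfer function and the energy estimate -/

section Transfer

variable {d : ℕ} {K : Fin d → Type*} [∀ i, NormedAddCommGroup (K i)]
  [∀ i, InnerProductSpace ℂ (K i)]

/-- The coefficients of `(1, z₁ u₁(z), …, z_d u_d(z))`, where `w` are those of `(f(z), u(z))`. -/
noncomputable def shiftInput (w : (Fin d → ℕ) → WithLp 2 (ℂ × PiLp 2 K)) (α : Fin d → ℕ) :
    WithLp 2 (ℂ × PiLp 2 K) :=
  WithLp.toLp 2 (if α = 0 then 1 else 0,
    WithLp.toLp 2 fun i => if α i = 0 then 0 else (w (α - Pi.single i 1)).snd i)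

omit [∀ i, InnerProductSpace ℂ (K i)] in
theorem shiftInput_congr {w w' : (Fin d → ℕ) → WithLp 2 (ℂ × PiLp 2 K)} {α : Fin d → ℕ}
    (h : ∀ β, ∑ i, β i < ∑ i, α i → w β = w' β) : shiftInput w α = shiftInput w' α := by
  have : (fun i => if α i = 0 then (0 : K i) else (w (α - Pi.single i 1)).snd i) =
      fun i => if α i = 0 then 0 else (w' (α - Pi.single i 1)).snd i := by
    funext i
    split_ifs with h0
    · rfl
    · rw [h]
      have := sum_add_single (α - Pi.single i 1) i
      rw [sub_single_add_single h0] at this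
      omega
  rw [shiftInput, shiftInput, this]

/-- Recursion on total degree: the input at α involves only values of `w` in degree |α| - 1. -/
theorem exists_transferCoeff (V : WithLp 2 (ℂ × PiLp 2 K) →L[ℂ] WithLp 2 (ℂ × PiLp 2 K)) :
    ∃ w : (Fin d → ℕ) → WithLp 2 (ℂ × PiLp 2 K), ∀ α, w α = V (shiftInput w α) := by
  -- `W n` is the n-th iterate from zero; its value at α no longer changes once n exceeds |α|.
  let W : ℕ → (Fin d → ℕ) → WithLp 2 (ℂ × PiLp 2 K) := fun n =>
    Nat.rec (fun _ => 0) (fun _ w α => V (shiftInput w α)) n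
  have hW : ∀ n m α, ∑ i, α i < n → ∑ i, α i < m → W n α = W m α := by
    intro n
    induction n with
    | zero => intro m α h; omega
    | succ n ih =>
      intro m α hn hm
      obtain ⟨m, rfl⟩ : ∃ k, m = k + 1 := ⟨m - 1, by omega⟩
      change V (shiftInput (W n) α) = V (shiftInput (W m) α)
      rw [shiftInput_congr fun β hβ => ih m β (by omega) (by omega)]
  refine ⟨fun α => W (∑ i, α i + 1) α, fun α => ?_⟩
  change V (shiftInput (W (∑ i, α i)) α) = _
  rw [shiftInput_congr fun β hβ => hW _ (∑ i, β i + 1) β hβ (Nat.lt_succ_self _)]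

variable {V : WithLp 2 (ℂ × PiLp 2 K) →L[ℂ] WithLp 2 (ℂ × PiLp 2 K)} (hV : ∀ x, ‖V x‖ ≤ ‖x‖)
  {w : (Fin d → ℕ) → WithLp 2 (ℂ × PiLp 2 K)} (hw : ∀ α, w α = V (shiftInput w α))
  {H : Type*} [NormedAddCommGroup H] [InnerProductSpace ℂ H] {τ : (Fin d → ℕ) → H}
  (hτ : ∀ (i : Fin d) (s : Finset (Fin d → ℕ)) (a : (Fin d → ℕ) → ℂ),
    ‖∑ α ∈ s, a α • τ (α + Pi.single i 1)‖ ≤ ‖∑ α ∈ s, a α • τ α‖)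

-- Energy balance for V ⊗ 1: output plus new state is at most input plus old state. Shifting the
-- state multiplies it by the coordinates, which `hτ` makes contractive on the τ side; the shift
-- also raises the degree, so truncation at n + 1 meets truncation at n.
include hV hw hτ in
theorem transfer_step (n : ℕ) :
    ‖∑ α ∈ multiIndexLT d (n + 1), (w α).fst • τ α‖ ^ 2 +
      ∑ i, (gramSum (multiIndexLT d (n + 1)) (fun α => (w α).snd i) τ).re ≤
    ‖τ 0‖ ^ 2 + ∑ i, (gramSum (multiIndexLT d n) (fun α => (w α).snd i) τ).re := by
  have h1 := gramSum_map_re_le V hV (multiIndexLT d (n + 1)) (shiftInput w) τ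
  simp only [← hw] at h1
  rw [gramSum_prod, gramSum_prod, gramSum_pi, gramSum_pi, Complex.add_re, Complex.add_re,
    gramSum_scalar, gramSum_scalar, Complex.re_sum, Complex.re_sum] at h1
  refine h1.trans (add_le_add (le_of_eq ?_) (Finset.sum_le_sum fun i _ => ?_))
  · have h2 : ∀ α, (shiftInput w α).fst = if α = 0 then 1 else 0 := fun α => rfl
    simp only [h2, ite_smul, one_smul, zero_smul]
    rw [Finset.sum_ite_eq', if_pos (mem_multiIndexLT.mpr (by simp))]
  · have h2 : ∀ α, (shiftInput w α).snd i =
        if α i = 0 then 0 else (w (α - Pi.single i 1)).snd i := fun α => rfl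
    have h3 : gramSum (multiIndexLT d (n + 1)) (fun α => (shiftInput w α).snd i) τ =
        gramSum (multiIndexLT d n) (fun α => (w α).snd i) fun α => τ (α + Pi.single i 1) := by
      simp only [gramSum, h2]
      rw [sum_multiIndexLT_succ i (fun α hα => by simp [hα])]
      refine Finset.sum_congr rfl fun α _ => ?_
      rw [sum_multiIndexLT_succ i (fun α hα => by simp [hα])]
      refine Finset.sum_congr rfl fun β _ => ?_
      simp
    rw [h3, gramSum_comm, gramSum_comm _ _ τ]
    exact gramSum_re_mono (hτ i _) _

include hV hw hτ in
theorem le_norm_sq_of_eventually_le {x : ℝ}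
    (hx : ∀ᶠ n in Filter.atTop, x ≤ ‖∑ α ∈ multiIndexLT d n, (w α).fst • τ α‖ ^ 2) :
    x ≤ ‖τ 0‖ ^ 2 := by
  refine le_of_forall_sum_range_le
    (s := fun n => ‖∑ α ∈ multiIndexLT d (n + 1), (w α).fst • τ α‖ ^ 2)
    (fun n => sq_nonneg _) (fun M => ?_) ((Filter.tendsto_add_atTop_nat 1).eventually hx)
  have key : ∑ n ∈ Finset.range M, ‖∑ α ∈ multiIndexLT d (n + 1), (w α).fst • τ α‖ ^ 2 +
      ∑ i, (gramSum (multiIndexLT d M) (fun α => (w α).snd i) τ).re ≤ M * ‖τ 0‖ ^ 2 := by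
    induction M with
    | zero => simp [gramSum, multiIndexLT]
    | succ M ih =>
      rw [Finset.sum_range_succ]
      have := transfer_step hV hw hτ M
      push_cast
      linarith
  have : 0 ≤ ∑ i, (gramSum (multiIndexLT d M) (fun α => (w α).snd i) τ).re :=
    Finset.sum_nonneg fun i _ => gramSum_nonneg _ _ _
  linarith

include hV hw hτ in
theorem norm_le_of_hasSum {y : H} (hy : HasSum (fun α => (w α).fst • τ α) y) : ‖y‖ ≤ ‖τ 0‖ := by
  have h1 : Filter.Tendsto (fun n => ‖∑ α ∈ multiIndexLT d n, (w α).fst • τ α‖ ^ 2) Filter.atTop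
      (nhds (‖y‖ ^ 2)) := ((hy.comp (tendsto_multiIndexLT d)).norm).pow 2
  refine (sq_le_sq₀ (norm_nonneg _) (norm_nonneg _)).mp (le_of_forall_lt_imp_le_of_dense ?_)
  intro x hx
  exact le_norm_sq_of_eventually_le hV hw hτ 
    ((h1.eventually (lt_mem_nhds hx)).mono fun _ => le_of_lt)

-- For τ an orthonormal family the index shifts are isometric, and the energy estimate becomes ∑
-- |c_α|² ≤ 1 on finite sums. No convergence is needed beforehand.
include hV hw in
theorem norm_transferCoeff_le_one (α : Fin d → ℕ) : ‖(w α).fst‖ ≤ 1 := by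
  classical
  let b : HilbertBasis (Fin d → ℕ) ℂ (lp (fun _ : Fin d → ℕ => ℂ) 2) :=
    ⟨LinearIsometryEquiv.refl ℂ _⟩
  have hb := b.orthonormal
  have hsum : ∀ (e : (Fin d → ℕ) → (Fin d → ℕ)), Function.Injective e →
      ∀ (s : Finset (Fin d → ℕ)) (a : (Fin d → ℕ) → ℂ),
      ‖∑ α ∈ s, a α • b (e α)‖ ^ 2 = ∑ α ∈ s, ‖a α‖ ^ 2 := by
    intro e he s a
    have h1 := (hb.comp e he).inner_sum a a s
    rw [inner_self_eq_norm_sq_to_K] at h1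
    simp only [Complex.conj_mul', Function.comp_apply] at h1
    apply Complex.ofReal_injective
    push_cast
    exact h1
  have h := le_norm_sq_of_eventually_le (τ := b) hV hw (fun i s a => ?_) (x := ‖(w α).fst‖ ^ 2) ?_
  · rw [hb.1 0] at h
    exact (sq_le_sq₀ (norm_nonneg _) zero_le_one).mp h
  · refine (sq_le_sq₀ (norm_nonneg _) (norm_nonneg _)).mp (le_of_eq ?_)
    rw [hsum _ (add_left_injective _), ← hsum id Function.injective_id]
    rfl
  · filter_upwards [Filter.eventually_gt_atTop (∑ i, α i)] with n hn
    have h1 := hsum id Function.injective_id (multiIndexLT d n) fun α => (w α).fst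
    simp only [id] at h1
    rw [h1]
    exact Finset.single_le_sum (f := fun α => ‖(w α).fst‖ ^ 2) (fun _ _ => sq_nonneg _)
      (mem_multiIndexLT.mpr hn)

end Transfer

/-! ### Monomials in commuting operators and absolute convergence -/

theorem summable_prod_pow : ∀ {d : ℕ} {x : Fin d → ℝ}, (∀ i, 0 ≤ x i) → (∀ i, x i < 1) →
    Summable fun α : Fin d → ℕ => ∏ i, x i ^ α i
  | 0, _, _, _ => (hasSum_fintype _).summable
  | d + 1, x, h0, h1 => by
    rw [← (Fin.consEquiv (fun _ : Fin (d + 1) => ℕ)).summable_iff]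
    have h := (summable_geometric_of_lt_one (h0 0) (h1 0)).mul_of_nonneg
      (summable_prod_pow (fun i => h0 (Fin.succ i)) (fun i => h1 i.succ))
      (fun n => pow_nonneg (h0 0) n)
      (fun α => Finset.prod_nonneg fun i _ => pow_nonneg (h0 i.succ) _)
    refine h.congr fun p => ?_
    simp [Fin.prod_univ_succ, Fin.consEquiv]

theorem listProd_add_single {M : Type*} [Monoid M] : ∀ {d : ℕ} {T : Fin d → M},
    (∀ i j, Commute (T i) (T j)) → ∀ (α : Fin d → ℕ) (i : Fin d),
    (List.ofFn fun j => T j ^ (α + Pi.single i 1 : Fin d → ℕ) j).prod =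
      T i * (List.ofFn fun j => T j ^ α j).prod
  | 0, _, _, _, i => i.elim0
  | d + 1, T, hT, α, i => by
    rw [List.ofFn_succ, List.ofFn_succ, List.prod_cons, List.prod_cons]
    refine Fin.cases ?_ (fun k => ?_) i
    · simp [pow_succ', mul_assoc]
    · have h := listProd_add_single (T := fun j : Fin d => T j.succ) (fun i j => hT _ _)
        (fun j => α j.succ) k
      have h1 : (fun j : Fin d => T j.succ ^ (α + Pi.single k.succ 1 : Fin (d + 1) → ℕ) j.succ) =
          fun j : Fin d =>
            T j.succ ^ ((fun j => α j.succ) + Pi.single k 1 : Fin d → ℕ) j := by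
        funext j
        by_cases hj : j = k
        · subst hj; simp
        · simp [hj]
      rw [h1, h, ← mul_assoc, ← mul_assoc]
      congr 1
      have h2 : (α + Pi.single k.succ 1 : Fin (d + 1) → ℕ) 0 = α 0 := by simp
      rw [h2]
      exact ((hT 0 k.succ).pow_left _).eq

theorem norm_listProd_le {H : Type*} [NormedAddCommGroup H] [NormedSpace ℂ H] :
    ∀ {d : ℕ} (T : Fin d → H →L[ℂ] H) (α : Fin d → ℕ),
    ‖(List.ofFn fun i => T i ^ α i).prod‖ ≤ ∏ i, ‖T i‖ ^ α i
  | 0, _, _ => by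
    rw [List.ofFn_zero, List.prod_nil, Fin.prod_univ_zero]
    exact ContinuousLinearMap.norm_id_le
  | d + 1, T, α => by
    rw [List.ofFn_succ, List.prod_cons, Fin.prod_univ_succ]
    refine (norm_mul_le _ _).trans (mul_le_mul ?_ (norm_listProd_le _ _) (norm_nonneg _)
      (pow_nonneg (norm_nonneg _) _))
    rcases Nat.eq_zero_or_pos (α 0) with h | h
    · rw [h, pow_zero, pow_zero]; exact ContinuousLinearMap.norm_id_le
    · exact norm_pow_le' _ h

/-- The power series of a function with bounded coefficients converges at every commuting tuple of
strict contractions. -/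
theorem summable_smul_listProd {d : ℕ} {H : Type*} [NormedAddCommGroup H] [NormedSpace ℂ H]
    [CompleteSpace H] {T : Fin d → H →L[ℂ] H} (hT : ∀ i, ‖T i‖ < 1) {c : (Fin d → ℕ) → ℂ} {C : ℝ}
    (hc : ∀ α, ‖c α‖ ≤ C) : Summable fun α => c α • (List.ofFn fun i => T i ^ α i).prod := by
  refine Summable.of_norm_bounded
    ((summable_prod_pow (fun i => norm_nonneg (T i)) hT).mul_left C) fun α => ?_
  rw [norm_smul]
  exact mul_le_mul (hc α) (norm_listProd_le T α) (norm_nonneg _) ((norm_nonneg _).trans (hc α))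

theorem exists_norm_le_lt_one {d : ℕ} {z : Fin d → ℂ} (hz : z ∈ polydisc d) :
    ∃ r : ℝ, 0 ≤ r ∧ r < 1 ∧ ∀ i, ‖z i‖ ≤ r :=
  ⟨‖z‖, norm_nonneg _, (pi_norm_lt_iff one_pos).mpr hz, norm_le_pi_norm z⟩

/-! ### The transfer coefficients are the Taylor coefficients of f -/

section Transfer

variable {d : ℕ} {K : Fin d → Type*} [∀ i, NormedAddCommGroup (K i)]
  [∀ i, InnerProductSpace ℂ (K i)]
  {V : WithLp 2 (ℂ × PiLp 2 K) →L[ℂ] WithLp 2 (ℂ × PiLp 2 K)} (hV : ∀ x, ‖V x‖ ≤ ‖x‖)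
  {w : (Fin d → ℕ) → WithLp 2 (ℂ × PiLp 2 K)} (hw : ∀ α, w α = V (shiftInput w α))

theorem WithLp.fst_finset_sum {ι E F : Type*} [AddCommGroup E] [AddCommGroup F] (s : Finset ι)
    (v : ι → WithLp 2 (E × F)) : (∑ j ∈ s, v j).fst = ∑ j ∈ s, (v j).fst := by
  classical
  induction s using Finset.induction_on with
  | empty => simp
  | insert a s ha ih => rw [Finset.sum_insert ha, Finset.sum_insert ha, WithLp.add_fst, ih]

theorem WithLp.snd_finset_sum {ι E F : Type*} [AddCommGroup E] [AddCommGroup F] (s : Finset ι)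
    (v : ι → WithLp 2 (E × F)) : (∑ j ∈ s, v j).snd = ∑ j ∈ s, (v j).snd := by
  classical
  induction s using Finset.induction_on with
  | empty => simp
  | insert a s ha ih => rw [Finset.sum_insert ha, Finset.sum_insert ha, WithLp.add_snd, ih]

theorem sum_pow_smul_shiftInput (z : Fin d → ℂ) (n : ℕ) :
    ∑ α ∈ multiIndexLT d (n + 1), (∏ i, z i ^ α i) • shiftInput w α =
      WithLp.toLp 2 (1, WithLp.toLp 2 fun i =>
        z i • (∑ α ∈ multiIndexLT d n, (∏ i, z i ^ α i) • w α).snd i) := by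
  have h1 : (∑ α ∈ multiIndexLT d (n + 1), (∏ i, z i ^ α i) • shiftInput w α).fst = 1 := by
    rw [WithLp.fst_finset_sum]
    have h2 : ∀ α, ((∏ i, z i ^ α i) • shiftInput w α).fst = if α = 0 then 1 else 0 := by
      intro α
      change (∏ i, z i ^ α i) * (if α = 0 then 1 else 0) = _
      split_ifs with h
      · simp [h]
      · simp
    simp only [h2]
    rw [Finset.sum_ite_eq', if_pos (mem_multiIndexLT.mpr (by simp))]
  have h3 : ∀ i, (∑ α ∈ multiIndexLT d (n + 1), (∏ i, z i ^ α i) • shiftInput w α).snd i =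
      z i • (∑ α ∈ multiIndexLT d n, (∏ i, z i ^ α i) • w α).snd i := by
    intro i
    rw [WithLp.snd_finset_sum, WithLp.snd_finset_sum, WithLp.ofLp_sum, WithLp.ofLp_sum,
      Finset.sum_apply, Finset.sum_apply, Finset.smul_sum]
    have h2 : ∀ α, ((∏ i, z i ^ α i) • shiftInput w α).snd i =
      (∏ i, z i ^ α i) • if α i = 0 then 0 else (w (α - Pi.single i 1)).snd i := fun α => rfl
    rw [sum_multiIndexLT_succ i fun α hα => by rw [h2, if_pos hα, smul_zero]]
    refine Finset.sum_congr rfl fun β _ => ?_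
    rw [h2, if_neg (by simp)]
    change _ = z i • ((∏ i, z i ^ β i) • (w β).snd i)
    rw [smul_smul, add_tsub_cancel_right]
    congr 1
    have := listProd_add_single (T := z) (fun i j => Commute.all _ _) β i
    rwa [List.prod_ofFn, List.prod_ofFn] at this
  refine (WithLp.ofLp_injective 2) (Prod.ext h1 ?_)
  exact PiLp.ext h3

-- The partial sums iterate the affine map y ↦ V(1, z_i y_i), which is r-Lipschitz for r = max |z_i|
-- < 1 and has `b` as fixed point.
include hV hw in
theorem tendsto_sum_transferCoeff {z : Fin d → ℂ} (hz : z ∈ polydisc d)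
    {b : WithLp 2 (ℂ × PiLp 2 K)}
    (hb : V (WithLp.toLp 2 (1, WithLp.toLp 2 fun i => z i • b.snd i)) = b) :
    Filter.Tendsto (fun n => ∑ α ∈ multiIndexLT d n, (∏ i, z i ^ α i) • w α) Filter.atTop
      (nhds b) := by
  obtain ⟨r, hr0, hr1, hr⟩ := exists_norm_le_lt_one hz
  set W := fun n => ∑ α ∈ multiIndexLT d n, (∏ i, z i ^ α i) • w α with hWdef
  have hW : ∀ n, W (n + 1) = V (WithLp.toLp 2 (1, WithLp.toLp 2 fun i => z i • (W n).snd i)) := by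
    intro n
    rw [← sum_pow_smul_shiftInput, map_sum]
    refine Finset.sum_congr rfl fun α _ => ?_
    rw [map_smul, ← hw]
  have hstep : ∀ n, ‖b - W (n + 1)‖ ≤ r * ‖b - W n‖ := by
    intro n
    have h1 : b - W (n + 1) =
        V (WithLp.toLp 2 (0, WithLp.toLp 2 fun i => z i • (b - W n).snd i)) := by
      rw [hW]
      nth_rw 1 [← hb]
      rw [← map_sub]
      congr 1
      refine (WithLp.ofLp_injective 2) (Prod.ext (sub_self _) (PiLp.ext fun i => ?_))
      exact (smul_sub _ _ _).symm
    rw [h1]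
    refine (hV _).trans ((sq_le_sq₀ (norm_nonneg _) (by positivity)).mp ?_)
    rw [mul_pow, WithLp.prod_norm_sq_eq_of_L2, WithLp.prod_norm_sq_eq_of_L2,
      PiLp.norm_sq_eq_of_L2, PiLp.norm_sq_eq_of_L2]
    change ‖(0 : ℂ)‖ ^ 2 + ∑ i, ‖z i • (b - W n).snd i‖ ^ 2 ≤
      r ^ 2 * (‖(b - W n).fst‖ ^ 2 + ∑ i, ‖(b - W n).snd i‖ ^ 2)
    simp only [norm_zero, norm_smul, mul_pow]
    have h2 : ∑ i, ‖z i‖ ^ 2 * ‖(b - W n).snd i‖ ^ 2 ≤ r ^ 2 * ∑ i, ‖(b - W n).snd i‖ ^ 2 := by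
      rw [Finset.mul_sum]
      refine Finset.sum_le_sum fun i _ => ?_
      gcongr
      exact hr i
    have h3 : 0 ≤ r ^ 2 * ‖(b - W n).fst‖ ^ 2 := by positivity
    linarith
  have hn : ∀ n, ‖b - W n‖ ≤ r ^ n * ‖b - W 0‖ := by
    intro n
    induction n with
    | zero => simp
    | succ n ih =>
      rw [pow_succ', mul_assoc]
      exact (hstep n).trans (mul_le_mul_of_nonneg_left ih hr0)
  have h0 : Filter.Tendsto (fun n => r ^ n * ‖b - W 0‖) Filter.atTop (nhds 0) := by
    simpa using (tendsto_pow_atTop_nhds_zero_of_lt_one hr0 hr1).mul_const ‖b - W 0‖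
  rw [tendsto_iff_norm_sub_tendsto_zero]
  refine squeeze_zero (fun _ => norm_nonneg _) (fun n => ?_) h0
  rw [norm_sub_rev]
  exact hn n

include hV hw in
theorem isPowerSeriesExpansion_transferCoeff {f : (Fin d → ℂ) → ℂ}
    {u : polydisc d → WithLp 2 (ℂ × PiLp 2 K)} (hu : ∀ z, (u z).fst = f z)
    (hVu : ∀ z : polydisc d,
      V (WithLp.toLp 2 (1, WithLp.toLp 2 fun i => (z : Fin d → ℂ) i • (u z).snd i)) = u z) :
    IsPowerSeriesExpansion f fun α => (w α).fst := by
  intro z hz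
  have hs : Summable fun α : Fin d → ℕ => (w α).fst * ∏ i, z i ^ α i := by
    refine Summable.of_norm_bounded (summable_prod_pow (fun i => norm_nonneg (z i)) hz) fun α => ?_
    rw [norm_mul, norm_prod]
    simp only [norm_pow]
    exact mul_le_of_le_one_left (Finset.prod_nonneg fun i _ => by positivity)
      (norm_transferCoeff_le_one hV hw α)
  have h1 := hs.hasSum.comp (tendsto_multiIndexLT d)
  have h2 := tendsto_sum_transferCoeff hV hw hz (hVu ⟨z, hz⟩)
  have h3 := ((WithLp.prod_continuous_ofLp 2 ℂ (PiLp 2 K)).fst.tendsto _).comp h2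
  have h4 := tendsto_nhds_unique h1 (h3.congr fun n => by
    change (∑ α ∈ multiIndexLT d n, (∏ i, z i ^ α i) • w α).fst = _
    rw [WithLp.fst_finset_sum]
    exact Finset.sum_congr rfl fun α _ => mul_comm _ _)
  have h5 := hs.hasSum
  rw [h4] at h5
  change HasSum _ (u ⟨z, hz⟩).fst at h5
  rwa [hu] at h5

end Transfer

/-! ### Sufficiency -/

/-- An Agler decomposition bounds the Schur–Agler norm. -/
theorem schurAglerNorm_le_one_of_decomposition {d : ℕ} {f : (Fin d → ℂ) → ℂ}
    {k : Fin d → polydisc d → polydisc d → ℂ} (hk : ∀ i, IsPositiveDefiniteKernel (k i))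
    (h : ∀ z w : polydisc d, 1 - f z * conj (f w) =
      ∑ i, (1 - (z : Fin d → ℂ) i * conj ((w : Fin d → ℂ) i)) * k i z w) :
    schurAglerNorm.{u} f ≤ 1 := by
  choose K hK1 hK2 hK3 v hv using fun i => exists_kolmogorov_decomposition (hk i)
  let b : polydisc d → WithLp 2 (ℂ × PiLp 2 K) := fun z =>
    WithLp.toLp 2 (f z, WithLp.toLp 2 fun i => v i z)
  let a : polydisc d → WithLp 2 (ℂ × PiLp 2 K) := fun z =>
    WithLp.toLp 2 (1, WithLp.toLp 2 fun i => (z : Fin d → ℂ) i • v i z)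
  obtain ⟨V, hV, hVa⟩ := exists_contraction_of_inner_eq a b fun z w => by
    simp only [a, b, WithLp.prod_inner_apply, PiLp.inner_apply, inner_smul_left, inner_smul_right,
      hv, RCLike.inner_apply, map_one, mul_one]
    have h1 := h w z
    simp only [sub_mul, one_mul, Finset.sum_sub_distrib] at h1
    simp only [mul_assoc] at h1
    linear_combination h1
  obtain ⟨w, hw⟩ := exists_transferCoeff V
  have hexp : IsPowerSeriesExpansion f fun α => (w α).fst :=
    isPowerSeriesExpansion_transferCoeff hV hw (u := b) (fun z => rfl) hVa
  refine iSup_le fun H => iSup_le fun _ => iSup_le fun _ => iSup_le fun _ => iSup_le fun T =>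
    iSup_le fun hT => iSup_le fun hT1 => ?_
  have hsum := (summable_smul_listProd hT1 (norm_transferCoeff_le_one hV hw)).hasSum
  rw [evalTuple, hexp.powerSeriesCoeff_eq, ← ofReal_norm, ENNReal.ofReal_le_one]
  refine ContinuousLinearMap.opNorm_le_bound _ zero_le_one fun x => ?_
  have hsumx := hsum.mapL (ContinuousLinearMap.apply ℂ H x)
  -- With τ α = T^α x, the shift hypothesis is just ‖T_i‖ ≤ 1 applied to a finite sum.
  have := norm_le_of_hasSum hV hw (τ := fun α => (List.ofFn fun i => T i ^ α i).prod x) ?_ hsumx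
  · simpa using this
  · intro i s c
    have h1 : ∑ α ∈ s, c α • (List.ofFn fun j => T j ^ (α + Pi.single i 1 : Fin d → ℕ) j).prod x =
        T i (∑ α ∈ s, c α • (List.ofFn fun j => T j ^ α j).prod x) := by
      simp only [listProd_add_single hT, map_sum, map_smul]
      rfl
    rw [h1]
    exact ((T i).le_opNorm _).trans (mul_le_of_le_one_left (norm_nonneg _) (hT1 i).le)

/-! ### Power series of bounded holomorphic functions -/

/-- The `n`-th Taylor coefficient at `0` of a function of one complex variable. -/
noncomputable def taylorCoeff (g : ℂ → ℂ) (n : ℕ) : ℂ := (n.factorial : ℂ)⁻¹ * iteratedDeriv n g 0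

section OneVariable

variable {g : ℂ → ℂ} {C : ℝ} (hg : DifferentiableOn ℂ g (Metric.ball 0 1))

include hg in
theorem hasSum_taylorCoeff {t : ℂ} (ht : ‖t‖ < 1) :
    HasSum (fun n => t ^ n * taylorCoeff g n) (g t) := by
  refine (Complex.hasSum_taylorSeries_on_ball hg (z := t) (by simpa using ht)).congr_fun ?_
  intro n
  simp only [taylorCoeff, sub_zero, smul_eq_mul]
  ring

variable (hC : ∀ t, ‖t‖ < 1 → ‖g t‖ ≤ C)

-- Cauchy's estimate on the circle of radius r, with r → 1.
include hg hC in
theorem norm_taylorCoeff_le (n : ℕ) : ‖taylorCoeff g n‖ ≤ C := by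
  have hr : ∀ r : ℝ, 0 < r → r < 1 → ‖taylorCoeff g n‖ * r ^ n ≤ C := by
    intro r hr0 hr1
    have h := Complex.norm_iteratedDeriv_le_of_forall_mem_sphere_norm_le (c := 0) (f := g) (C := C)
      n hr0 ((hg.mono (Metric.closedBall_subset_ball hr1)).diffContOnCl_ball le_rfl)
      fun z hz => hC z (by rw [mem_sphere_zero_iff_norm.mp hz]; exact hr1)
    have hn : (0 : ℝ) < n.factorial := by exact_mod_cast n.factorial_pos
    rw [taylorCoeff, norm_mul, norm_inv, Complex.norm_natCast, inv_mul_eq_div, div_mul_eq_mul_div,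
      div_le_iff₀ hn]
    rw [le_div_iff₀ (pow_pos hr0 n)] at h
    linarith
  have h1 : Filter.Tendsto (fun r : ℝ => ‖taylorCoeff g n‖ * r ^ n) (nhdsWithin 1 (Set.Iio 1))
      (nhds (‖taylorCoeff g n‖ * 1 ^ n)) :=
    (Continuous.tendsto (by fun_prop) 1).mono_left nhdsWithin_le_nhds
  rw [one_pow, mul_one] at h1
  refine le_of_tendsto h1 ?_
  filter_upwards [Ioo_mem_nhdsLT (zero_lt_one' ℝ)] with r hr01 using hr r hr01.1 hr01.2

include hg hC in
theorem norm_sub_sum_taylorCoeff_le (n : ℕ) {t : ℂ} (ht : ‖t‖ < 1) :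
    ‖g t - ∑ k ∈ Finset.range n, t ^ k * taylorCoeff g k‖ ≤ C * ‖t‖ ^ n / (1 - ‖t‖) := by
  have h := (hasSum_nat_add_iff' n).mpr (hasSum_taylorCoeff hg ht)
  have h1 : HasSum (fun k => C * ‖t‖ ^ n * ‖t‖ ^ k) (C * ‖t‖ ^ n / (1 - ‖t‖)) := by
    rw [div_eq_mul_inv]
    exact (hasSum_geometric_of_lt_one (norm_nonneg _) ht).mul_left _
  rw [← h.tsum_eq]
  refine tsum_of_norm_bounded h1 fun k => ?_
  rw [norm_mul, norm_pow, pow_add, mul_comm]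
  have := norm_taylorCoeff_le hg hC (k + n)
  have h2 : 0 ≤ ‖t‖ ^ k * ‖t‖ ^ n := by positivity
  nlinarith

end OneVariable

/-- The Taylor coefficients in the first variable of a bounded separately holomorphic function of
two variables are holomorphic in the second variable. -/
theorem differentiableOn_taylorCoeff {F : ℂ → ℂ → ℂ} {C : ℝ}
    (h1 : ∀ s, ‖s‖ < 1 → DifferentiableOn ℂ (fun t => F t s) (Metric.ball 0 1))
    (h2 : ∀ t, ‖t‖ < 1 → DifferentiableOn ℂ (F t) (Metric.ball 0 1))
    (hC : ∀ t s, ‖t‖ < 1 → ‖s‖ < 1 → ‖F t s‖ ≤ C) (n : ℕ) :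
    DifferentiableOn ℂ (fun s => taylorCoeff (fun t => F t s) n) (Metric.ball 0 1) := by
  induction n using Nat.strong_induction_on with
  | _ n ih =>
    have hC0 : 0 ≤ C := (norm_nonneg _).trans (hC 0 0 (by simp) (by simp))
    -- The n-th coefficient is the limit, as t → 0, of the order-n remainder over t^n. The geometric
    -- bound on the tail makes this uniform in s, and holomorphy survives; the induction handles the
    -- lower coefficients.
    have hlim : TendstoUniformlyOn
        (fun t s => (F t s - ∑ k ∈ Finset.range n, t ^ k * taylorCoeff (fun t => F t s) k) / t ^ n)
        (fun s => taylorCoeff (fun t => F t s) n) (nhdsWithin 0 {0}ᶜ) (Metric.ball 0 1) := by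
      rw [Metric.tendstoUniformlyOn_iff]
      intro ε hε
      have h3 : Filter.Tendsto (fun t : ℂ => C * ‖t‖ / (1 - ‖t‖)) (nhdsWithin 0 {0}ᶜ) (nhds 0) := by
        have : ContinuousAt (fun t : ℂ => C * ‖t‖ / (1 - ‖t‖)) 0 :=
          ContinuousAt.div (by fun_prop) (by fun_prop) (by simp)
        simpa using this.tendsto.mono_left (nhdsWithin_le_nhds (s := {0}ᶜ))
      filter_upwards [h3.eventually (gt_mem_nhds hε), self_mem_nhdsWithin,
        mem_nhdsWithin_of_mem_nhds (Metric.ball_mem_nhds (0 : ℂ) one_pos)] with t ht ht0 ht1 s hs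
      have ht0 : t ≠ 0 := ht0
      have ht1 : ‖t‖ < 1 := by simpa using ht1
      have hs : ‖s‖ < 1 := by simpa using hs
      have h4 := norm_sub_sum_taylorCoeff_le (h1 s hs) (fun t ht => hC t s ht hs) (n + 1) ht1
      rw [Finset.sum_range_succ] at h4
      rw [dist_eq_norm]
      have htn : t ^ n ≠ 0 := pow_ne_zero n ht0
      have h5 : taylorCoeff (fun t => F t s) n -
          (F t s - ∑ k ∈ Finset.range n, t ^ k * taylorCoeff (fun t => F t s) k) / t ^ n =
          -((F t s - (∑ k ∈ Finset.range n, t ^ k * taylorCoeff (fun t => F t s) k +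
            t ^ n * taylorCoeff (fun t => F t s) n)) / t ^ n) := by
        field_simp
        ring
      rw [h5, norm_neg, norm_div, norm_pow]
      have htp : 0 < ‖t‖ ^ n := pow_pos (norm_pos_iff.mpr ht0) n
      refine lt_of_le_of_lt ?_ ht
      rw [div_le_iff₀ htp]
      refine h4.trans (le_of_eq ?_)
      ring
    refine hlim.tendstoLocallyUniformlyOn.differentiableOn ?_ Metric.isOpen_ball
    filter_upwards [mem_nhdsWithin_of_mem_nhds (Metric.ball_mem_nhds (0 : ℂ) one_pos)] with t ht
    refine ((h2 t (by simpa using ht)).sub ?_).div_const _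
    refine DifferentiableOn.fun_sum fun k hk => ?_
    exact (ih k (Finset.mem_range.mp hk)).const_mul _

theorem mem_polydisc_cons {d : ℕ} {t : ℂ} {w : Fin d → ℂ} (ht : ‖t‖ < 1) (hw : w ∈ polydisc d) :
    (Fin.cons t w : Fin (d + 1) → ℂ) ∈ polydisc (d + 1) := fun i =>
  Fin.cases (by simpa using ht) (fun j => by simpa using hw j) i

theorem update_mem_polydisc {d : ℕ} {t : ℂ} {w : Fin d → ℂ} (ht : ‖t‖ < 1) (hw : w ∈ polydisc d)
    (i : Fin d) : Function.update w i t ∈ polydisc d := fun j => by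
  by_cases h : j = i
  · subst h; simpa using ht
  · simpa [h] using hw j

/-- **Osgood's lemma** for bounded functions: a bounded separately holomorphic function on the
polydisc is the sum of a power series, with coefficients bounded by the same constant. -/
theorem exists_isPowerSeriesExpansion_of_separately : ∀ {d : ℕ} {f : (Fin d → ℂ) → ℂ} {C : ℝ},
    (∀ z ∈ polydisc d, ∀ i,
      DifferentiableOn ℂ (fun t => f (Function.update z i t)) (Metric.ball 0 1)) →
    (∀ z ∈ polydisc d, ‖f z‖ ≤ C) →
    ∃ c, (∀ α, ‖c α‖ ≤ C) ∧ IsPowerSeriesExpansion f c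
  | 0, f, C, _, hC => by
    refine ⟨fun _ => f 0, fun _ => hC 0 fun i => i.elim0, fun z _ => ?_⟩
    simp [Subsingleton.elim z 0]
  | d + 1, f, C, hf, hC => by
    have h0 : ∀ w ∈ polydisc d,
        DifferentiableOn ℂ (fun t => f (Fin.cons t w)) (Metric.ball 0 1) := by
      intro w hw
      have h := hf (Fin.cons 0 w) (mem_polydisc_cons (by simp) hw) 0
      simpa only [Fin.update_cons_zero] using h
    have hsucc : ∀ n, ∃ c : (Fin d → ℕ) → ℂ, (∀ α, ‖c α‖ ≤ C) ∧
        IsPowerSeriesExpansion (fun w => taylorCoeff (fun t => f (Fin.cons t w)) n) c := by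
      intro n
      refine exists_isPowerSeriesExpansion_of_separately (fun w hw i => ?_) fun w hw =>
        norm_taylorCoeff_le (h0 w hw) (fun t ht => hC _ (mem_polydisc_cons ht hw)) n
      refine differentiableOn_taylorCoeff (F := fun t s => f (Fin.cons t (Function.update w i s)))
        (C := C) (fun s hs => h0 _ (update_mem_polydisc hs hw i)) (fun t ht => ?_)
        (fun t s ht hs => hC _ (mem_polydisc_cons ht (update_mem_polydisc hs hw i))) n
      have h := hf (Fin.cons t w) (mem_polydisc_cons ht hw) i.succ
      simpa only [Fin.cons_update] using h
    choose c hc hexp using hsucc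
    refine ⟨fun α => c (α 0) (Fin.tail α), fun α => hc _ _, fun z hz => ?_⟩
    have hw : Fin.tail z ∈ polydisc d := fun i => hz i.succ
    have hs : Summable fun α : Fin (d + 1) → ℕ => c (α 0) (Fin.tail α) * ∏ i, z i ^ α i := by
      refine Summable.of_norm_bounded
        ((summable_prod_pow (fun i => norm_nonneg (z i)) hz).mul_left C) fun α => ?_
      rw [norm_mul, norm_prod]
      simp only [norm_pow]
      exact mul_le_mul_of_nonneg_right (hc _ _) (Finset.prod_nonneg fun i _ => by positivity)
    have hs' := (Fin.consEquiv (fun _ : Fin (d + 1) => ℕ)).summable_iff.mpr hs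
    have h1 : ∀ n, HasSum (fun β : Fin d → ℕ => c n β * ∏ i, z (Fin.succ i) ^ β i)
        (taylorCoeff (fun t => f (Fin.cons t (Fin.tail z))) n) := fun n => hexp n _ hw
    have h2 := hs'.hasSum.prod_fiberwise (f := (fun α : Fin (d + 1) → ℕ =>
        c (α 0) (Fin.tail α) * ∏ i, z i ^ α i) ∘ Fin.consEquiv (fun _ : Fin (d + 1) => ℕ))
      (g := fun n => z 0 ^ n * taylorCoeff (fun t => f (Fin.cons t (Fin.tail z))) n) fun n => by
        refine ((h1 n).mul_left (z 0 ^ n)).congr_fun fun β => ?_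
        simp [Fin.consEquiv, Fin.prod_univ_succ, Fin.tail_cons]
        ring
    have h3 := h2.unique (hasSum_taylorCoeff (h0 _ hw) (hz 0))
    have h4 := hs'.hasSum
    rw [h3, Fin.cons_self_tail] at h4
    exact (Equiv.hasSum_iff _).mp h4

theorem exists_isPowerSeriesExpansion {d : ℕ} {f : (Fin d → ℂ) → ℂ} {C : ℝ}
    (hf : DifferentiableOn ℂ f (polydisc d)) (hC : ∀ z ∈ polydisc d, ‖f z‖ ≤ C) :
    ∃ c, (∀ α, ‖c α‖ ≤ C) ∧ IsPowerSeriesExpansion f c := by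
  refine exists_isPowerSeriesExpansion_of_separately (fun z hz i => ?_) hC
  refine hf.comp (fun t _ => ?_) fun t ht => update_mem_polydisc (by simpa using ht) hz i
  refine (differentiableAt_pi.mpr fun j => ?_).differentiableWithinAt
  by_cases h : j = i
  · subst h; simp
  · simp [h]

/-! ### From a positive functional to a tuple of strict contractions -/

/-- The new norm is placed on a separate type because `ι → ℂ`, to which this is applied, already
carries the sup norm. -/
theorem exists_linearEquiv_of_core {V : Type u} [AddCommGroup V] [Module ℂ V]
    (c : InnerProductSpace.Core ℂ V) :
    ∃ (H : Type u) (_ : NormedAddCommGroup H) (_ : InnerProductSpace ℂ H) (e : V ≃ₗ[ℂ] H),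
      ∀ v, ‖e v‖ ^ 2 = (c.inner v v).re := by
  let _ : NormedAddCommGroup V := c.toNormedAddCommGroup
  let _ : InnerProductSpace ℂ V := InnerProductSpace.ofCore c.toCore
  exact ⟨V, _, _, LinearEquiv.refl ℂ V, fun v => (inner_self_eq_norm_sq (𝕜 := ℂ) v).symm⟩

/-- The rank one kernel `g(p) conj (h(q))`. -/
def outerKernel {ι : Type*} (g h : ι → ℂ) : ι → ι → ℂ := fun p q => g p * conj (h q)

/-- A linear functional on kernels which is positive on rank one kernels induces a Hilbert space
structure on functions. -/
theorem exists_hilbert_of_functional {ι : Type u} [Fintype ι] (ℓ : (ι → ι → ℂ) →ₗ[ℂ] ℂ)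
    (hℓ : ∀ g : ι → ℂ, g ≠ 0 → 0 < (ℓ (outerKernel g g)).re) :
    ∃ (H : Type u) (_ : NormedAddCommGroup H) (_ : InnerProductSpace ℂ H) (e : (ι → ℂ) ≃ₗ[ℂ] H),
      ∀ g, ‖e g‖ ^ 2 = (ℓ (outerKernel g g)).re := by
  have hadd1 : ∀ g g' h : ι → ℂ, outerKernel (g + g') h = outerKernel g h + outerKernel g' h := by
    intro g g' h; funext p q; simp [outerKernel, add_mul]
  have hadd2 : ∀ g h h' : ι → ℂ, outerKernel g (h + h') = outerKernel g h + outerKernel g h' := by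
    intro g g' h; funext p q; simp [outerKernel, mul_add]
  have hsmul1 : ∀ (r : ℂ) (g h : ι → ℂ), outerKernel (r • g) h = r • outerKernel g h := by
    intro r g h; funext p q; simp [outerKernel, mul_assoc]
  have hsmul2 : ∀ (r : ℂ) (g h : ι → ℂ), outerKernel g (r • h) = conj r • outerKernel g h := by
    intro r g h; funext p q; simp [outerKernel]; ring
  have hself : ∀ g : ι → ℂ, ((ℓ (outerKernel g g) + conj (ℓ (outerKernel g g))) / 2 : ℂ) =
      ((ℓ (outerKernel g g)).re : ℂ) := by
    intro g; rw [Complex.add_conj]; push_cast; ring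
  have hnonneg : ∀ g : ι → ℂ, 0 ≤ (ℓ (outerKernel g g)).re := by
    intro g
    by_cases hg : g = 0
    · have : outerKernel (0 : ι → ℂ) 0 = 0 := by funext p q; simp [outerKernel]
      rw [hg, this]; simp
    · exact (hℓ g hg).le
  let c : InnerProductSpace.Core ℂ (ι → ℂ) :=
    -- ℓ need not be real on Hermitian kernels; symmetrising makes the form Hermitian and keeps Re ℓ
    -- on the diagonal.
    { inner := fun g h => (ℓ (outerKernel h g) + conj (ℓ (outerKernel g h))) / 2
      conj_inner_symm := fun g h => by
        simp only [map_div₀, map_add, Complex.conj_conj, map_ofNat, add_comm]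
      re_inner_nonneg := fun g => by
        rw [hself]; exact hnonneg g
      add_left := fun g g' h => by
        rw [hadd1, hadd2]; simp only [map_add]; ring
      smul_left := fun g h r => by
        rw [hsmul1, hsmul2]; simp only [map_smul, smul_eq_mul, map_mul]; ring
      definite := fun g hg => by
        by_contra hne
        have h1 := hℓ g hne
        rw [hself] at hg
        exact h1.ne' (by exact_mod_cast hg) }
  obtain ⟨H, i1, i2, e, he⟩ := exists_linearEquiv_of_core c
  refine ⟨H, i1, i2, e, fun g => ?_⟩
  rw [he]
  change ((ℓ (outerKernel g g) + conj (ℓ (outerKernel g g))) / 2 : ℂ).re = _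
  rw [hself, Complex.ofReal_re]

/-- Evaluating `f` at the multiplication operators by the coordinates on a finite dimensional space
of functions gives the multiplication operator by `f`. -/
theorem evalTuple_mul {d : ℕ} {ι : Type u} [Fintype ι] {f : (Fin d → ℂ) → ℂ}
    {c : (Fin d → ℕ) → ℂ} (hf : IsPowerSeriesExpansion f c) (x : ι → polydisc d)
    {H : Type u} [NormedAddCommGroup H] [InnerProductSpace ℂ H] (e : (ι → ℂ) ≃ₗ[ℂ] H)
    {T : Fin d → H →L[ℂ] H}
    (hT : ∀ i g, T i (e g) = e fun p => (x p : Fin d → ℂ) i * g p) (g : ι → ℂ) :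
    evalTuple f T (e g) = e fun p => f (x p) * g p := by
  have : FiniteDimensional ℂ H := e.finiteDimensional
  let Φ : (ι → ℂ) →ₐ[ℂ] (H →L[ℂ] H) :=
    ((Module.End.toContinuousLinearMap H).toAlgHom.comp (e.conjAlgEquiv ℂ).toAlgHom).comp
      (Algebra.lmul ℂ (ι → ℂ))
  have hΦ : ∀ a g, Φ a (e g) = e (a * g) := by
    intro a g
    change e (a * e.symm (e g)) = e (a * g)
    rw [e.symm_apply_apply]
  have hTΦ : ∀ i, T i = Φ fun p => (x p : Fin d → ℂ) i := by
    intro i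
    ext v
    obtain ⟨g, rfl⟩ := e.surjective v
    rw [hT, hΦ]
    rfl
  have hsum : HasSum (fun α : Fin d → ℕ => c α • fun p => ∏ i, (x p : Fin d → ℂ) i ^ α i)
      (fun p => f (x p)) := by
    rw [Pi.hasSum]
    exact fun p => hf _ (x p).2
  have hcont : Continuous Φ.toLinearMap := LinearMap.continuous_of_finiteDimensional _
  have h1 := hsum.map Φ.toLinearMap hcont
  have h2 : (Φ.toLinearMap ∘ fun α : Fin d → ℕ => c α • fun p => ∏ i, (x p : Fin d → ℂ) i ^ α i) =
      fun α => c α • (List.ofFn fun i => T i ^ α i).prod := by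
    funext α
    have h3 : (fun p => ∏ i, (x p : Fin d → ℂ) i ^ α i) =
        (List.ofFn fun i => (fun p => (x p : Fin d → ℂ) i) ^ α i).prod := by
      rw [List.prod_ofFn]
      funext p
      simp
    rw [Function.comp_apply, map_smul, h3, AlgHom.toLinearMap_apply, map_list_prod, List.map_ofFn]
    congr 3
    funext i
    rw [Function.comp_apply, map_pow, hTΦ]
  rw [h2] at h1
  rw [evalTuple, hf.powerSeriesCoeff_eq, h1.tsum_eq]
  exact hΦ _ g

/-- If a functional on kernels over a finite subset of the polydisc is strictly positive on the
kernels `(1 - z_i conj w_i) g(z) conj (g(w))`, then it is nonnegative on `1 - f(z) conj (f(w))`. -/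
theorem functional_nonneg_of_schurAglerNorm_le_one {d : ℕ} (hd : 1 ≤ d) {ι : Type u} [Fintype ι]
    {f : (Fin d → ℂ) → ℂ} {c : (Fin d → ℕ) → ℂ} (hf : IsPowerSeriesExpansion f c)
    (hSA : schurAglerNorm.{u} f ≤ 1) (x : ι → polydisc d) (ℓ : (ι → ι → ℂ) →L[ℂ] ℂ)
    {η : ℝ} (hη : 0 < η)
    (hℓ : ∀ i g, η * ‖g‖ ^ 2 ≤ (ℓ fun p q =>
      (1 - (x p : Fin d → ℂ) i * conj ((x q : Fin d → ℂ) i)) * outerKernel g g p q).re) :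
    0 ≤ (ℓ fun p q => 1 - f (x p) * conj (f (x q))).re := by
  let Q : (ι → ℂ) → ℝ := fun g => (ℓ (outerKernel g g)).re
  let m : Fin d → (ι → ℂ) → ι → ℂ := fun i g p => (x p : Fin d → ℂ) i * g p
  have hQm : ∀ i g, Q (m i g) + η * ‖g‖ ^ 2 ≤ Q g := by
    intro i g
    have h1 : (fun p q => (1 - (x p : Fin d → ℂ) i * conj ((x q : Fin d → ℂ) i)) *
        outerKernel g g p q) = outerKernel g g - outerKernel (m i g) (m i g) := by
      funext p q
      simp only [outerKernel, m, Pi.sub_apply, map_mul]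
      ring
    have h2 := hℓ i g
    rw [h1, map_sub, Complex.sub_re] at h2
    linarith
  have hQcont : Continuous Q := by
    have : Continuous fun g : ι → ℂ => outerKernel g g := by
      unfold outerKernel
      fun_prop
    fun_prop
  have hQ0 : Q 0 = 0 := by
    have : outerKernel (0 : ι → ℂ) 0 = 0 := by funext p q; simp [outerKernel]
    simp only [Q, this, map_zero, Complex.zero_re]
  -- Q does not increase under multiplication by a coordinate, and the iterates tend to 0 because
  -- |x_i| < 1; so Q g ≥ Q 0 = 0. A coordinate exists as d ≥ 1.
  have hQnonneg : ∀ g, 0 ≤ Q g := by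
    intro g
    let i : Fin d := ⟨0, hd⟩
    have h1 : ∀ n, Q ((m i)^[n] g) ≤ Q g := by
      intro n
      induction n with
      | zero => exact le_rfl
      | succ n ih =>
        rw [Function.iterate_succ_apply']
        have := hQm i ((m i)^[n] g)
        have h3 : 0 ≤ η * ‖(m i)^[n] g‖ ^ 2 := by positivity
        linarith
    have h2 : ∀ n, (m i)^[n] g = fun p => (x p : Fin d → ℂ) i ^ n * g p := by
      intro n
      induction n with
      | zero => simp
      | succ n ih =>
        rw [Function.iterate_succ_apply', ih]
        funext p
        simp only [m, pow_succ']
        ring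
    have h3 : Filter.Tendsto (fun n => (m i)^[n] g) Filter.atTop (nhds 0) := by
      simp only [h2]
      rw [tendsto_pi_nhds]
      intro p
      simpa using (tendsto_pow_atTop_nhds_zero_of_norm_lt_one ((x p).2 i)).mul_const (g p)
    have h4 := (hQcont.tendsto 0).comp h3
    rw [hQ0] at h4
    exact le_of_tendsto h4 (Filter.Eventually.of_forall h1)
  have hQη : ∀ g, η * ‖g‖ ^ 2 ≤ Q g := fun g => by
    have := hQm ⟨0, hd⟩ g
    have := hQnonneg (m ⟨0, hd⟩ g)
    linarith
  obtain ⟨H, _, _, e, he⟩ := exists_hilbert_of_functional ℓ.toLinearMap fun g hg => by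
    have h1 : 0 < ‖g‖ := norm_pos_iff.mpr hg
    exact (by positivity : 0 < η * ‖g‖ ^ 2).trans_le (hQη g)
  have he : ∀ g, ‖e g‖ ^ 2 = Q g := he
  have : FiniteDimensional ℂ H := e.finiteDimensional
  have : CompleteSpace H := FiniteDimensional.complete ℂ H
  have hQA : ∀ g, Q g ≤ ‖ℓ‖ * ‖g‖ ^ 2 := by
    intro g
    refine (Complex.re_le_norm _).trans ((ℓ.le_opNorm _).trans ?_)
    refine mul_le_mul_of_nonneg_left ?_ (norm_nonneg _)
    refine (pi_norm_le_iff_of_nonneg (by positivity)).mpr fun p =>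
      (pi_norm_le_iff_of_nonneg (by positivity)).mpr fun q => ?_
    rw [outerKernel, norm_mul, RCLike.norm_conj, sq]
    exact mul_le_mul (norm_le_pi_norm g p) (norm_le_pi_norm g q) (norm_nonneg _) (norm_nonneg _)
  let mlin : Fin d → (ι → ℂ) →ₗ[ℂ] (ι → ℂ) := fun i =>
    LinearMap.mulLeft ℂ fun p => (x p : Fin d → ℂ) i
  let T : Fin d → H →L[ℂ] H := fun i =>
    LinearMap.toContinuousLinearMap (e.toLinearMap ∘ₗ mlin i ∘ₗ e.symm.toLinearMap)
  have hT : ∀ i g, T i (e g) = e (m i g) := by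
    intro i g
    change e (mlin i (e.symm (e g))) = _
    rw [e.symm_apply_apply]
    rfl
  have hcomm : ∀ i j, Commute (T i) (T j) := by
    intro i j
    ext v
    obtain ⟨g, rfl⟩ := e.surjective v
    change T i (T j (e g)) = T j (T i (e g))
    rw [hT, hT, hT, hT]
    congr 1
    funext p
    simp only [m]
    ring
  have hnorm : ∀ i, ‖T i‖ < 1 := by
    intro i
    -- Since Q g ≤ A ‖g‖², the margin η ‖g‖² is at least (η / A) Q g, whence ‖T_i‖² ≤ 1 - η / A.
    set A := ‖ℓ‖ + η with hA
    have hA0 : 0 < A := by positivity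
    have hηA : η / A ≤ 1 := (div_le_one hA0).mpr (by linarith [norm_nonneg ℓ])
    have hηA0 : 0 < η / A := by positivity
    refine (ContinuousLinearMap.opNorm_le_bound _ (Real.sqrt_nonneg (1 - η / A)) fun v => ?_).trans_lt
      ?_
    · obtain ⟨g, rfl⟩ := e.surjective v
      refine (sq_le_sq₀ (norm_nonneg _) (by positivity)).mp ?_
      rw [mul_pow, Real.sq_sqrt (by linarith), hT, he, he]
      have h1 := hQm i g
      have h2 : Q g ≤ A * ‖g‖ ^ 2 := (hQA g).trans (by nlinarith [sq_nonneg ‖g‖])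
      have h3 : η / A * Q g ≤ η * ‖g‖ ^ 2 := by
        calc η / A * Q g ≤ η / A * (A * ‖g‖ ^ 2) := by gcongr
          _ = η * ‖g‖ ^ 2 := by field_simp
      linarith
    · rw [Real.sqrt_lt' one_pos]
      linarith
  have hle : ‖evalTuple f T‖ ≤ 1 := by
    rw [← ENNReal.ofReal_le_one, ofReal_norm]
    refine le_trans ?_ hSA
    refine le_iSup_of_le H (le_iSup_of_le _ (le_iSup_of_le _ (le_iSup_of_le inferInstance
      (le_iSup_of_le T (le_iSup_of_le hcomm (le_iSup_of_le hnorm le_rfl))))))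
  have h1 := (evalTuple f T).le_of_opNorm_le hle (e 1)
  rw [one_mul, evalTuple_mul hf x e hT] at h1
  have h2 := pow_le_pow_left₀ (norm_nonneg _) h1 2
  rw [he, he] at h2
  have h3 : (fun p q => 1 - f (x p) * conj (f (x q))) =
      outerKernel (1 : ι → ℂ) 1 -
        outerKernel (fun p => f (x p) * (1 : ι → ℂ) p) (fun p => f (x p) * (1 : ι → ℂ) p) := by
    funext p q
    simp [outerKernel]
  rw [h3, map_sub, Complex.sub_re]
  exact sub_nonneg.mpr h2

/-! ### Positive definite kernels -/

section Kernel

variable {X : Type u} {k : X → X → ℂ}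

theorem IsPositiveDefiniteKernel.norm_sq_le (hk : IsPositiveDefiniteKernel k) (x y : X) :
    ‖k x y‖ ^ 2 ≤ (k x x).re * (k y y).re := by
  obtain ⟨K, _, _, _, u, hu⟩ := exists_kolmogorov_decomposition hk
  have h : ∀ x, (k x x).re = ‖u x‖ ^ 2 := fun x => by
    rw [← hu]; exact inner_self_eq_norm_sq (𝕜 := ℂ) (u x)
  rw [h, h, ← mul_pow, ← hu, mul_comm]
  exact pow_le_pow_left₀ (norm_nonneg _) (norm_inner_le_norm _ _) 2

theorem IsPositiveDefiniteKernel.re_nonneg (hk : IsPositiveDefiniteKernel k) (x : X) :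
    0 ≤ (k x x).re := by
  obtain ⟨K, _, _, _, u, hu⟩ := exists_kolmogorov_decomposition hk
  rw [← hu]
  exact inner_self_nonneg (𝕜 := ℂ) (x := u x)

end Kernel

section Kernel

variable {X : Type*}

open scoped ComplexOrder in
theorem IsPositiveDefiniteKernel.add {k k' : X → X → ℂ} (hk : IsPositiveDefiniteKernel k)
    (hk' : IsPositiveDefiniteKernel k') : IsPositiveDefiniteKernel (k + k') :=
  Matrix.PosSemidef.add (A := Matrix.of k) (B := Matrix.of k') hk hk'

open scoped ComplexOrder in
theorem IsPositiveDefiniteKernel.smul {k : X → X → ℂ} (hk : IsPositiveDefiniteKernel k) {r : ℝ}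
    (hr : 0 ≤ r) : IsPositiveDefiniteKernel (r • k) :=
  Matrix.PosSemidef.smul (x := Matrix.of k) hk hr

open scoped ComplexOrder in
theorem isPositiveDefiniteKernel_zero : IsPositiveDefiniteKernel (0 : X → X → ℂ) :=
  Matrix.PosSemidef.zero

open scoped ComplexOrder in
theorem isPositiveDefiniteKernel_inner {K : Type*} [NormedAddCommGroup K] [InnerProductSpace ℂ K]
    (u : X → K) : IsPositiveDefiniteKernel fun x y => inner ℂ (u y) (u x) := by
  refine ⟨Matrix.IsHermitian.ext fun p q => inner_conj_symm _ _, fun v => ?_⟩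
  have h : (v.sum fun i xi => v.sum fun j xj =>
      star xi * Matrix.of (fun x y => inner ℂ (u y) (u x)) i j * xj) =
        inner ℂ (v.sum fun i xi => conj xi • u i) (v.sum fun i xi => conj xi • u i) := by
    simp only [Finsupp.sum]
    rw [Finset.sum_comm, sum_inner]
    refine Finset.sum_congr rfl fun i _ => ?_
    rw [inner_sum]
    refine Finset.sum_congr rfl fun j _ => ?_
    rw [inner_smul_left, inner_smul_right, Complex.conj_conj, Matrix.of_apply, RCLike.star_def]
    ring
  rw [h]
  exact RCLike.nonneg_iff.mpr ⟨inner_self_nonneg, inner_self_im _⟩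

theorem isPositiveDefiniteKernel_outerKernel (g : X → ℂ) :
    IsPositiveDefiniteKernel (outerKernel g g) :=
  isPositiveDefiniteKernel_inner g

open scoped ComplexOrder in
theorem isClosed_isPositiveDefiniteKernel :
    IsClosed {k : X → X → ℂ | IsPositiveDefiniteKernel k} := by
  have h : {k : X → X → ℂ | IsPositiveDefiniteKernel k} =
      (⋂ p, ⋂ q, {k : X → X → ℂ | star (k q p) = k p q}) ∩
        ⋂ v : X →₀ ℂ, {k | 0 ≤ v.sum fun i xi => v.sum fun j xj => star xi * k i j * xj} := by
    ext k
    simp only [Set.mem_ofPred_eq, Set.mem_inter_iff, Set.mem_iInter, IsPositiveDefiniteKernel,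
      Matrix.PosSemidef, Matrix.IsHermitian.ext_iff, Matrix.of_apply]
  rw [h]
  refine IsClosed.inter ?_ ?_
  · refine isClosed_iInter fun p => isClosed_iInter fun q => isClosed_eq ?_ ?_ <;> fun_prop
  · refine isClosed_iInter fun v => isClosed_le continuous_const ?_
    refine continuous_finsetSum _ fun i _ => continuous_finsetSum _ fun j _ => ?_
    fun_prop

/-! ### The Agler cone and its compactness -/

/-- The sum `∑ i, (1 - z_i conj w_i) k_i(z, w)`, restricted to a family of points. -/
noncomputable def aglerSum {d : ℕ} (x : X → polydisc d) :
    (Fin d → X → X → ℂ) →ₗ[ℝ] (X → X → ℂ) where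
  toFun k p q := ∑ i, (1 - (x p : Fin d → ℂ) i * conj ((x q : Fin d → ℂ) i)) * k i p q
  map_add' k k' := by
    funext p q
    simp [mul_add, Finset.sum_add_distrib]
  map_smul' r k := by
    funext p q
    simp only [Pi.smul_apply, RingHom.id_apply, Complex.real_smul, Finset.mul_sum]
    exact Finset.sum_congr rfl fun i _ => by ring

theorem aglerSum_apply {d : ℕ} (x : X → polydisc d) (k : Fin d → X → X → ℂ) (p q : X) :
    aglerSum x k p q =
      ∑ i, (1 - (x p : Fin d → ℂ) i * conj ((x q : Fin d → ℂ) i)) * k i p q := rfl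

theorem continuous_aglerSum {d : ℕ} (x : X → polydisc d) : Continuous (aglerSum x) := by
  refine continuous_pi fun p => continuous_pi fun q => ?_
  simp only [aglerSum_apply]
  fun_prop

theorem one_sub_mul_conj (z : ℂ) : 1 - z * conj z = ((1 - ‖z‖ ^ 2 : ℝ) : ℂ) := by
  rw [Complex.mul_conj']; push_cast; ring

theorem one_sub_norm_sq_pos {z : ℂ} (hz : ‖z‖ < 1) : 0 < 1 - ‖z‖ ^ 2 := by
  have := norm_nonneg z
  nlinarith

end Kernel

/-- On the diagonal all summands are nonnegative, so nothing cancels. With Cauchy–Schwarz off the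
diagonal, this is the source of all compactness below. -/
theorem re_diag_le_of_aglerSum {X : Type u} {d : ℕ} (x : X → polydisc d) {k : Fin d → X → X → ℂ}
    (hk : ∀ i, IsPositiveDefiniteKernel (k i)) (i : Fin d) (p : X) :
    (1 - ‖(x p : Fin d → ℂ) i‖ ^ 2) * (k i p p).re ≤ (aglerSum x k p p).re := by
  rw [aglerSum_apply, Complex.re_sum]
  simp only [one_sub_mul_conj, Complex.re_ofReal_mul]
  exact Finset.single_le_sum
    (f := fun i => (1 - ‖(x p : Fin d → ℂ) i‖ ^ 2) * (k i p p).re)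
    (fun i _ => mul_nonneg (one_sub_norm_sq_pos ((x p).2 i)).le ((hk i).re_nonneg p))
    (Finset.mem_univ i)

theorem norm_le_of_aglerSum {X : Type u} {d : ℕ} (x : X → polydisc d) {k : Fin d → X → X → ℂ}
    (hk : ∀ i, IsPositiveDefiniteKernel (k i)) {B : ℝ} (hB : ∀ p, (aglerSum x k p p).re ≤ B)
    (i : Fin d) (p q : X) :
    ‖k i p q‖ ^ 2 ≤ B / (1 - ‖(x p : Fin d → ℂ) i‖ ^ 2) * (B / (1 - ‖(x q : Fin d → ℂ) i‖ ^ 2)) := by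
  have h : ∀ p, (k i p p).re ≤ B / (1 - ‖(x p : Fin d → ℂ) i‖ ^ 2) := fun p => by
    rw [le_div_iff₀' (one_sub_norm_sq_pos ((x p).2 i))]
    exact (re_diag_le_of_aglerSum x hk i p).trans (hB p)
  exact ((hk i).norm_sq_le p q).trans
    (mul_le_mul (h p) (h q) ((hk i).re_nonneg q) (((hk i).re_nonneg p).trans (h p)))

/-- The compact box containing all Agler decompositions whose sums have diagonal at most `B`. -/
def aglerBox {X : Type u} {d : ℕ} (x : X → polydisc d) (B : ℝ) : Set (Fin d → X → X → ℂ) :=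
  Set.univ.pi fun i => Set.univ.pi fun p => Set.univ.pi fun q => Metric.closedBall 0
    (Real.sqrt (B / (1 - ‖(x p : Fin d → ℂ) i‖ ^ 2) * (B / (1 - ‖(x q : Fin d → ℂ) i‖ ^ 2))))

theorem isCompact_aglerBox {X : Type u} {d : ℕ} (x : X → polydisc d) (B : ℝ) :
    IsCompact (aglerBox x B) :=
  isCompact_univ_pi fun _ => isCompact_univ_pi fun _ => isCompact_univ_pi fun _ =>
    isCompact_closedBall _ _

theorem mem_aglerBox {X : Type u} {d : ℕ} {x : X → polydisc d} {B : ℝ} {k : Fin d → X → X → ℂ}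
    (hk : ∀ i, IsPositiveDefiniteKernel (k i)) (hB : ∀ p, (aglerSum x k p p).re ≤ B) :
    k ∈ aglerBox x B := fun i _ p _ q _ => by
  rw [mem_closedBall_zero_iff]
  exact Real.le_sqrt_of_sq_le (norm_le_of_aglerSum x hk hB i p q)

theorem isClosed_forall_isPositiveDefiniteKernel {X : Type*} {d : ℕ} :
    IsClosed {k : Fin d → X → X → ℂ | ∀ i, IsPositiveDefiniteKernel (k i)} := by
  have h : {k : Fin d → X → X → ℂ | ∀ i, IsPositiveDefiniteKernel (k i)} =
      ⋂ i, (fun k => k i) ⁻¹' {k : X → X → ℂ | IsPositiveDefiniteKernel k} := by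
    ext k; simp
  rw [h]
  exact isClosed_iInter fun i => isClosed_isPositiveDefiniteKernel.preimage (continuous_apply i)

/-- The cone of all sums `∑ i, (1 - z_i conj w_i) k_i(z, w)` over a family of points. -/
def aglerCone {X : Type*} {d : ℕ} (x : X → polydisc d) : Set (X → X → ℂ) :=
  aglerSum x '' {k | ∀ i, IsPositiveDefiniteKernel (k i)}

theorem convex_aglerCone {X : Type*} {d : ℕ} (x : X → polydisc d) : Convex ℝ (aglerCone x) := by
  refine Convex.linear_image ?_ _
  intro k hk k' hk' a b ha hb _ i
  exact ((hk i).smul ha).add ((hk' i).smul hb)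

/-- Near a limit point the sums have bounded diagonals, so their decompositions stay in a compact
set, whose image is closed. -/
theorem isClosed_aglerCone {ι : Type u} [Fintype ι] {d : ℕ} (x : ι → polydisc d) :
    IsClosed (aglerCone x) := by
  refine isClosed_of_closure_subset fun M hM => ?_
  set B := ‖M‖ + 1
  have hcpt : IsCompact (aglerSum x '' (aglerBox x B ∩ {k | ∀ i, IsPositiveDefiniteKernel (k i)})) :=
    ((isCompact_aglerBox x B).inter_right isClosed_forall_isPositiveDefiniteKernel).image
      (continuous_aglerSum x)
  have hM1 : M ∈ closure (Metric.ball M 1 ∩ aglerCone x) :=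
    mem_closure_iff_nhds.mpr fun t ht => by
      obtain ⟨y, hy, hy'⟩ := mem_closure_iff_nhds.mp hM _
        (Filter.inter_mem ht (Metric.ball_mem_nhds M one_pos))
      exact ⟨y, hy.1, hy.2, hy'⟩
  have hsub : Metric.ball M 1 ∩ aglerCone x ⊆
      aglerSum x '' (aglerBox x B ∩ {k | ∀ i, IsPositiveDefiniteKernel (k i)}) := by
    rintro _ ⟨hN, k, hk, rfl⟩
    refine ⟨k, ⟨mem_aglerBox hk fun p => ?_, hk⟩, rfl⟩
    refine (Complex.re_le_norm _).trans (((norm_le_pi_norm _ p).trans (norm_le_pi_norm _ p)).trans ?_)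
    have h1 : ‖aglerSum x k‖ ≤ ‖M‖ + ‖aglerSum x k - M‖ := norm_le_norm_add_norm_sub' _ _
    have h2 : ‖aglerSum x k - M‖ < 1 := by simpa [dist_eq_norm] using hN
    linarith
  obtain ⟨k, hk, hkM⟩ := closure_minimal hsub hcpt.isClosed hM1
  exact ⟨k, hk.2, hkM⟩

/-! ### Separation over finitely many points -/

/-- The Agler decomposition over a finite family of points. -/
theorem mem_aglerCone_of_schurAglerNorm_le_one {d : ℕ} (hd : 1 ≤ d) {ι : Type u} [Fintype ι]
    {f : (Fin d → ℂ) → ℂ} {c : (Fin d → ℕ) → ℂ} (hf : IsPowerSeriesExpansion f c)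
    (hSA : schurAglerNorm.{u} f ≤ 1) (x : ι → polydisc d) :
    (fun p q => 1 - f (x p) * conj (f (x q))) ∈ aglerCone x := by
  classical
  by_contra hmem
  set M : ι → ι → ℂ := fun p q => 1 - f (x p) * conj (f (x q)) with hM
  obtain ⟨ℓ, u, hu, hcone⟩ := RCLike.geometric_hahn_banach_point_closed (𝕜 := ℂ)
    (convex_aglerCone x) (isClosed_aglerCone x) hmem
  have hu0 : u < 0 := by
    have := hcone 0 ⟨0, fun i => isPositiveDefiniteKernel_zero, map_zero _⟩
    simpa using this
  have hpos : ∀ N ∈ aglerCone x, 0 ≤ (ℓ N).re := by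
    rintro _ ⟨k, hk, rfl⟩
    by_contra! hneg
    have hr : 0 ≤ u / (ℓ (aglerSum x k)).re := div_nonneg_of_nonpos hu0.le hneg.le
    -- This rescaling takes the value exactly `u` under Re ℓ, but the cone lies strictly above `u`.
    have := hcone _ ⟨(u / (ℓ (aglerSum x k)).re) • k, fun i => (hk i).smul hr, map_smul _ _ _⟩
    rw [ContinuousLinearMap.map_smul_of_tower] at this
    simp only [RCLike.re_eq_complex_re, Complex.smul_re, smul_eq_mul] at this
    rw [div_mul_cancel₀ _ hneg.ne] at this
    exact lt_irrefl _ this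
  have hMneg : (ℓ M).re < 0 := lt_trans hu hu0
  -- The trace is strictly positive on (1 - z_i conj w_i) g conj g, with margin (1 - r²) ‖g‖²; a
  -- small multiple ε gives the definiteness and the strict contractions without losing negativity
  -- at M.
  let tr : (ι → ι → ℂ) →L[ℂ] ℂ :=
    ∑ p, (ContinuousLinearMap.proj p).comp (ContinuousLinearMap.proj p : (ι → ι → ℂ) →L[ℂ] ι → ℂ)
  have htr : ∀ N, tr N = ∑ p, N p p := fun N => by simp [tr]
  obtain ⟨r, hr0, hr1, hr⟩ : ∃ r : ℝ, 0 ≤ r ∧ r < 1 ∧ ∀ p i, ‖(x p : Fin d → ℂ) i‖ ≤ r := by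
    refine ⟨‖fun p => (x p : Fin d → ℂ)‖, norm_nonneg _, ?_, fun p i =>
      (norm_le_pi_norm _ i).trans (norm_le_pi_norm (fun p => (x p : Fin d → ℂ)) p)⟩
    exact (pi_norm_lt_iff one_pos).mpr fun p => (pi_norm_lt_iff one_pos).mpr (x p).2
  obtain ⟨ε, hε, hεM⟩ : ∃ ε : ℝ, 0 < ε ∧ (ℓ M).re + ε * (tr M).re < 0 := by
    have h1 : Filter.Tendsto (fun ε : ℝ => (ℓ M).re + ε * (tr M).re) (nhdsWithin 0 (Set.Ioi 0))
        (nhds ((ℓ M).re + 0 * (tr M).re)) :=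
      (Continuous.tendsto (by fun_prop) 0).mono_left nhdsWithin_le_nhds
    rw [zero_mul, add_zero] at h1
    obtain ⟨ε, h2, h3⟩ := ((h1.eventually (gt_mem_nhds hMneg)).and self_mem_nhdsWithin).exists
    exact ⟨ε, h3, h2⟩
  have hη : 0 < ε * (1 - r ^ 2) := mul_pos hε (by nlinarith)
  have h := functional_nonneg_of_schurAglerNorm_le_one hd hf hSA x (ℓ + (ε : ℂ) • tr) hη ?_
  · rw [← hM] at h
    simp only [add_apply, smul_apply, smul_eq_mul, Complex.add_re,
      Complex.re_ofReal_mul] at h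
    linarith
  · intro i g
    set N : ι → ι → ℂ := fun p q =>
      (1 - (x p : Fin d → ℂ) i * conj ((x q : Fin d → ℂ) i)) * outerKernel g g p q with hN
    have h1 : 0 ≤ (ℓ N).re := by
      refine hpos _ ⟨Pi.single i (outerKernel g g), fun j => ?_, ?_⟩
      · by_cases hj : j = i
        · subst hj
          rw [Pi.single_eq_same]
          exact isPositiveDefiniteKernel_outerKernel g
        · rw [Pi.single_eq_of_ne hj]
          exact isPositiveDefiniteKernel_zero
      · funext p q
        rw [aglerSum_apply, Finset.sum_eq_single i]
        · rw [Pi.single_eq_same]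
        · intro j _ hj
          rw [Pi.single_eq_of_ne hj]
          simp
        · simp
    have h2 : (1 - r ^ 2) * ‖g‖ ^ 2 ≤ (tr N).re := by
      have h3 : (tr N).re = ∑ p, (1 - ‖(x p : Fin d → ℂ) i‖ ^ 2) * ‖g p‖ ^ 2 := by
        rw [htr, Complex.re_sum]
        refine Finset.sum_congr rfl fun p _ => ?_
        simp only [hN]
        rw [one_sub_mul_conj, Complex.re_ofReal_mul, outerKernel, Complex.mul_conj']
        norm_cast
      have h4 : ‖g‖ ^ 2 ≤ ∑ p, ‖g p‖ ^ 2 := by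
        refine (Real.le_sqrt (norm_nonneg _) (by positivity)).mp
          ((pi_norm_le_iff_of_nonneg (Real.sqrt_nonneg _)).mpr fun p => Real.le_sqrt_of_sq_le ?_)
        exact Finset.single_le_sum (f := fun p => ‖g p‖ ^ 2) (fun _ _ => sq_nonneg _)
          (Finset.mem_univ p)
      rw [h3]
      refine (mul_le_mul_of_nonneg_left h4 (by nlinarith)).trans ?_
      rw [Finset.mul_sum]
      refine Finset.sum_le_sum fun p _ => mul_le_mul_of_nonneg_right ?_ (sq_nonneg _)
      have := pow_le_pow_left₀ (norm_nonneg _) (hr p i) 2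
      linarith
    simp only [add_apply, smul_apply, smul_eq_mul, Complex.add_re, Complex.re_ofReal_mul]
    nlinarith

/-! ### From finite sets to the polydisc -/

/-- An Agler decomposition exists as soon as it exists over all finite sets of points. -/
theorem exists_decomposition_of_schurAglerNorm_le_one {d : ℕ} (hd : 1 ≤ d)
    {f : (Fin d → ℂ) → ℂ} {c : (Fin d → ℕ) → ℂ} (hf : IsPowerSeriesExpansion f c)
    (hSA : schurAglerNorm.{u} f ≤ 1) :
    ∃ k : Fin d → polydisc d → polydisc d → ℂ, (∀ i, IsPositiveDefiniteKernel (k i)) ∧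
      ∀ z w : polydisc d, 1 - f z * conj (f w) =
        ∑ i, (1 - (z : Fin d → ℂ) i * conj ((w : Fin d → ℂ) i)) * k i z w := by
  classical
  let M : polydisc d → polydisc d → ℂ := fun z w => 1 - f z * conj (f w)
  -- Decompositions valid on F × F, inside one compact box. The bound 1 suffices because 1 - |f|² ≤
  -- 1 on the diagonal.
  let A : Finset (polydisc d) → Set (Fin d → polydisc d → polydisc d → ℂ) := fun F =>
    (aglerBox id 1 ∩ {k | ∀ i, IsPositiveDefiniteKernel (k i)}) ∩
      ⋂ p ∈ F, ⋂ q ∈ F, {k | aglerSum id k p q = M p q}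
  have hcpt : IsCompact (aglerBox (X := polydisc d) id 1 ∩
      {k | ∀ i, IsPositiveDefiniteKernel (k i)}) :=
    (isCompact_aglerBox id 1).inter_right isClosed_forall_isPositiveDefiniteKernel
  have hclosed : ∀ F : Finset (polydisc d), IsClosed (⋂ p ∈ F, ⋂ q ∈ F,
      {k : Fin d → polydisc d → polydisc d → ℂ | aglerSum id k p q = M p q}) := fun F =>
    isClosed_biInter fun p _ => isClosed_biInter fun q _ => isClosed_eq
      ((continuous_apply q).comp ((continuous_apply p).comp (continuous_aglerSum id)))
      continuous_const
  have hne : ∀ F, (A F).Nonempty := by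
    intro F
    -- `ULift` moves the points to the universe of the Hilbert spaces in the supremum.
    obtain ⟨K, hK, hKM⟩ := mem_aglerCone_of_schurAglerNorm_le_one hd hf hSA
      (fun p : ULift.{u} F => (p.down : polydisc d))
    choose E _ _ _ v hv using fun i => exists_kolmogorov_decomposition (hK i)
    -- Extending the Kolmogorov vectors by zero off F extends the kernels to the whole polydisc and
    -- keeps them positive definite.
    let e : ∀ i, polydisc d → E i := fun i p => if h : p ∈ F then v i ⟨⟨p, h⟩⟩ else 0
    let k : Fin d → polydisc d → polydisc d → ℂ := fun i p q => inner ℂ (e i q) (e i p)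
    have hk : ∀ i, IsPositiveDefiniteKernel (k i) := fun i => isPositiveDefiniteKernel_inner _
    have hkM : ∀ p ∈ F, ∀ q ∈ F, aglerSum id k p q = M p q := by
      intro p hp q hq
      have h1 := congrFun (congrFun hKM ⟨⟨p, hp⟩⟩) ⟨⟨q, hq⟩⟩
      rw [aglerSum_apply] at h1 ⊢
      refine Eq.trans (Finset.sum_congr rfl fun i _ => ?_) h1
      simp only [k, e, dif_pos hp, dif_pos hq, hv, id]
    refine ⟨k, ⟨mem_aglerBox hk fun p => ?_, hk⟩, ?_⟩
    · by_cases hp : p ∈ F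
      · rw [hkM p hp p hp]
        simp only [M]
        rw [one_sub_mul_conj, Complex.ofReal_re]
        linarith [sq_nonneg ‖f p‖]
      · rw [aglerSum_apply, Finset.sum_eq_zero fun i _ => by simp [k, e, dif_neg hp]]
        simp
    · simp only [Set.mem_iInter]
      exact hkM
  obtain ⟨k, hk⟩ := IsCompact.nonempty_iInter_of_directed_nonempty_isCompact_isClosed A
    (fun F G => ⟨F ∪ G,
      Set.inter_subset_inter_right _
        (Set.biInter_mono Finset.subset_union_left fun p _ =>
          Set.biInter_mono Finset.subset_union_left fun q _ => subset_rfl),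
      Set.inter_subset_inter_right _
        (Set.biInter_mono Finset.subset_union_right fun p _ =>
          Set.biInter_mono Finset.subset_union_right fun q _ => subset_rfl)⟩)
    hne (fun F => hcpt.inter_right (hclosed F)) (fun F => hcpt.isClosed.inter (hclosed F))
  rw [Set.mem_iInter] at hk
  refine ⟨k, (hk ∅).1.2, fun z w => ?_⟩
  have h1 := (hk {z, w}).2
  simp only [Set.mem_iInter] at h1
  exact (h1 z (by simp) w (by simp)).symm

theorem mainTheorem6 (d : ℕ) (hd : 1 ≤ d) (f : (Fin d → ℂ) → ℂ)
    (hf : DifferentiableOn ℂ f (polydisc d))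
    (hbdd : ∃ C : ℝ, ∀ z ∈ polydisc d, ‖f z‖ ≤ C) :
    schurAglerNorm.{u} f ≤ 1 ↔
      ∃ k : Fin d → polydisc d → polydisc d → ℂ,
        (∀ i, IsPositiveDefiniteKernel (k i)) ∧
        ∀ z w : polydisc d,
          1 - f z * conj (f w) =
            ∑ i, (1 - (z : Fin d → ℂ) i * conj ((w : Fin d → ℂ) i)) * k i z w := by
  obtain ⟨C, hC⟩ := hbdd
  obtain ⟨c, -, hc⟩ := exists_isPowerSeriesExpansion hf hC
  exact ⟨exists_decomposition_of_schurAglerNorm_le_one hd hc, fun ⟨k, hk, h⟩ =>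
    schurAglerNorm_le_one_of_decomposition hk h⟩
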